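/- Let $(\mathcal X,\nu)$ be a measure space (e.g. $\mathbb C$ with Lebesgue measure), let $\bar f$ be a probability density with respect to $\nu$ and let $f(\cdot;\theta)$, $\theta\in[\theta_{\min},\theta_{\max}]$, be a family of probability densities with respect to $\nu$. Let $x_0,x_1,\dots$ be i.i.d. with density $\bar f$, write $\mathbf x=(x_0,\dots,x_{N-1})$ and $f(\mathbf x;\theta)=\prod_{n=0}^{N-1}f(x_n;\theta)$, and let the misspecified maximum likelihood (MML) estimator $\hat\theta_N=\hat\theta_N(\mathbf x)$ be a measurable maximizer of $f(\mathbf x;\theta)$ over $\theta\in[\theta_{\min},\theta_{\max}]$. Assume the following. (A1) For $\bar f$-almost every $x$, $f(x;\theta)>0$ for all $\theta\in[\theta_{\min},\theta_{\max}]$, and $\theta\mapsto\ln f(x;\theta)$ is three times continuously differentiable on $[\theta_{\min},\theta_{\max}]$ (one-sided derivatives at the end points). (A2) There are functions $b_0,b_1,b_2,b_3$ with $\int b_i^2\,\bar f\,d\nu<\infty$ such that, for $\bar f$-almost every $x$, $\left|\frac{\partial^i}{\partial\theta^i}\ln f(x;\theta)\right|\le b_i(x)$ for all $\theta\in[\theta_{\min},\theta_{\max}]$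 and $i=0,1,2,3$. (A3) $\int|\ln\bar f|\,\bar f\,d\nu<\infty$, and the Kullback–Leibler divergence $D(\bar f\,\|\,f(\cdot;\theta))=\int\bar f\ln\frac{\bar f}{f(\cdot;\theta)}\,d\nu$, as a function of $\theta\in[\theta_{\min},\theta_{\max}]$, has a unique minimum, at a point $\theta_*\in(\theta_{\min},\theta_{\max})$. Define the predicted statistic and the true statistic of the MML estimator with $N$ measurements by $$\widehat V_N(\theta_*)=2\int_{(\theta_{\min}-\theta_*)/2}^{(\theta_{\max}-\theta_*)/2}|\epsilon|\,P\big(f(\mathbf x;\theta_*+2\epsilon)\ge f(\mathbf x;\theta_*)\big)\,d\epsilon,\qquad V_N(\theta_*)=\mathbb E\big[(\hat\theta_N-\theta_*)^2\big],$$ and put $$\mathcal A(\theta_*)=\mathbb E_{\bar f}\Big[\frac{\partial^2}{\partial\theta^2}\ln f(x;\theta_*)\Big],\qquad \mathcal B(\theta_*)=\mathbb E_{\bar f}\Big[\Big(\frac{\partial}{\partial\theta}\ln f(x;\theta_*)\Big)^2\Big].$$ Then the integral defining $\widehat V_N(\theta_*)$ converges for every $N$, and $\hat\theta_N\to\theta_*$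 almost surely as $N\to\infty$. If moreover (A4) $\mathcal A(\theta_*)\neq0$, then: (i) the large sample asymptotic variance $V=\lim_{N\to\infty}N\,V_N(\theta_*)$ of the MML estimator exists (as a real number), and $N\,\widehat V_N(\theta_*)\to V$ as $N\to\infty$; (ii) if the MML estimator is asymptotically misspecified efficient, i.e. $N\,V_N(\theta_*)\to\mathcal B(\theta_*)/\mathcal A^2(\theta_*)$, then $N\,\widehat V_N(\theta_*)\to\mathcal B(\theta_*)/\mathcal A^2(\theta_*)$ as $N\to\infty$, the misspecified Cramér–Rao lower bound (per measurement). -/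

import Mathlib

open Set Filter Topology MeasureTheory ProbabilityTheory

noncomputable section

namespace MML

/-- `g` is a probability density with respect to the reference measure `ν`. -/
def IsDensity {𝒳 : Type*} [MeasurableSpace 𝒳] (ν : Measure 𝒳) (g : 𝒳 → ℝ) : Prop :=
  Measurable g ∧ (∀ x, 0 ≤ g x) ∧ ∫⁻ x, ENNReal.ofReal (g x) ∂ν = 1

/-- The law with density `g` with respect to `ν`. -/
def law {𝒳 : Type*} [MeasurableSpace 𝒳] (ν : Measure 𝒳) (g : 𝒳 → ℝ) : Measure 𝒳 :=
  ν.withDensity (fun x => ENNReal.ofReal (g x))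

/-- The Kullback-Leibler divergence `D(g ‖ h) = ∫ g ln (g / h)` between two densities. -/
def klDivergence {𝒳 : Type*} [MeasurableSpace 𝒳] (ν : Measure 𝒳) (g h : 𝒳 → ℝ) : ℝ :=
  ∫ x, g x * Real.log (g x / h x) ∂ν

/-- The `i`-th derivative of `ln f(x;θ)` with respect to `θ ∈ [a, b]`
(one-sided at the two end points). -/
def dLog {𝒳 : Type*} (f : 𝒳 → ℝ → ℝ) (a b : ℝ) (i : ℕ) (x : 𝒳) (θ : ℝ) : ℝ :=
  iteratedDerivWithin i (fun t => Real.log (f x t)) (Icc a b) θ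

/-- `𝒜(θ)`: the mean, under the true law `P`, of the second derivative of `ln f(x;θ)`. -/
def meanHessian {𝒳 : Type*} [MeasurableSpace 𝒳] (P : Measure 𝒳) (f : 𝒳 → ℝ → ℝ)
    (a b θ : ℝ) : ℝ :=
  ∫ x, dLog f a b 2 x θ ∂P

/-- `ℬ(θ)`: the mean, under the true law `P`, of the squared derivative of `ln f(x;θ)`. -/
def meanSqScore {𝒳 : Type*} [MeasurableSpace 𝒳] (P : Measure 𝒳) (f : 𝒳 → ℝ → ℝ)
    (a b θ : ℝ) : ℝ :=
  ∫ x, (dLog f a b 1 x θ) ^ 2 ∂P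

/-- The misspecified Cramer-Rao lower bound (per observation) `ℬ(θ) / 𝒜(θ)²`. -/
def mcrlb {𝒳 : Type*} [MeasurableSpace 𝒳] (P : Measure 𝒳) (f : 𝒳 → ℝ → ℝ)
    (a b θ : ℝ) : ℝ :=
  meanSqScore P f a b θ / meanHessian P f a b θ ^ 2

/-- The assumed likelihood of `N` measurements. -/
def likelihood {𝒳 : Type*} (f : 𝒳 → ℝ → ℝ) {N : ℕ} (x : Fin N → 𝒳) (θ : ℝ) : ℝ :=
  ∏ n, f (x n) θ

/-- The vector of the first `N` measurements. -/
def sample {Ω 𝒳 : Type*} (X : ℕ → Ω → 𝒳) (N : ℕ) (ω : Ω) : Fin N → 𝒳 :=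
  fun n => X n ω

/-- The true estimator statistic `E[(θ̂ - θ)²]` with `N` measurements. -/
def trueStatistic {Ω 𝒳 : Type*} [MeasurableSpace Ω] (μ : Measure Ω) (X : ℕ → Ω → 𝒳)
    (θhat : (N : ℕ) → (Fin N → 𝒳) → ℝ) (θ : ℝ) (N : ℕ) : ℝ :=
  ∫ ω, (θhat N (sample X N ω) - θ) ^ 2 ∂μ

/-- The integrand `|ε| P(f(𝐱;θ+2ε) ≥ f(𝐱;θ))` of the predicted statistic. -/
def predictedIntegrand {Ω 𝒳 : Type*} [MeasurableSpace Ω] (μ : Measure Ω) (X : ℕ → Ω → 𝒳)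
    (f : 𝒳 → ℝ → ℝ) (θ : ℝ) (N : ℕ) (ε : ℝ) : ℝ :=
  |ε| * μ.real {ω | likelihood f (sample X N ω) (θ + 2 * ε) ≥ likelihood f (sample X N ω) θ}

/-- The predicted statistic for a parameter with finite support `[a, b]`. -/
def predictedStatistic {Ω 𝒳 : Type*} [MeasurableSpace Ω] (μ : Measure Ω) (X : ℕ → Ω → 𝒳)
    (f : 𝒳 → ℝ → ℝ) (a b θ : ℝ) (N : ℕ) : ℝ :=
  2 * ∫ ε in ((a - θ) / 2)..((b - θ) / 2), predictedIntegrand μ X f θ N ε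

/-- The estimators `θ̂` have large sample asymptotic variance `V` about `θ`:
`N E[(θ̂ - θ)²] → V` as `N → ∞`. -/
def HasAsymptoticVariance {Ω 𝒳 : Type*} [MeasurableSpace Ω] (μ : Measure Ω) (X : ℕ → Ω → 𝒳)
    (θhat : (N : ℕ) → (Fin N → 𝒳) → ℝ) (θ V : ℝ) : Prop :=
  Tendsto (fun N : ℕ => (N : ℝ) * trueStatistic μ X θhat θ N) atTop (𝓝 V)

/-- Asymptotic misspecified efficiency: the asymptotic variance is the misspecified
Cramer-Rao lower bound. -/
def AsymptoticallyMisspecifiedEfficient {Ω 𝒳 : Type*} [MeasurableSpace Ω] [MeasurableSpace 𝒳]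
    (μ : Measure Ω) (X : ℕ → Ω → 𝒳) (P : Measure 𝒳) (f : 𝒳 → ℝ → ℝ) (a b : ℝ)
    (θhat : (N : ℕ) → (Fin N → 𝒳) → ℝ) (θ : ℝ) : Prop :=
  HasAsymptoticVariance μ X θhat θ (mcrlb P f a b θ)

end MML

end

/-! Let `t` be the minimizer of the divergence, `α = -𝒜(t)` and `S` the empirical mean of the score
at `t`. Minimality makes the score centred and `α ≥ 0`. For small `η`, outside an event of
probability `o(1/N)`, the normalized log-likelihood at `t + u` minus its value at `t` is negative
for `|u| ≥ δ` and within `η u² / 2` of `u S - α u² / 2` for `|u| ≤ δ`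
(`RegularModel.exists_locallyQuadratic`).

On the good event both statistics lie between `S² / (α + η)²` and `S² / (α - η)²`. For the estimator
this is the score equation. For the predicted statistic, Fubini gives the expectation of `2 ∫ |ε|`
over the `ε` at which `t + 2ε` is at least as likely as `t`; this set is nearly the interval between
`0` and `S / α`, over which `2 ∫ |ε|` is exactly `(S / α)²`.

Both quantities are bounded, so the bad event contributes `o(1)` after multiplication by `N`. Since
`N E[S²] = ℬ` exactly and `N S²` is uniformly integrable, both limits are `ℬ / 𝒜²`
(`tendsto_mul_integral_of_sandwich`); no central limit theorem enters. With second moments only,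
Chebyshev gives `O(1/N)` for the bad event; uniform integrability, proved by truncation and fourth
moments, improves this to `o(1/N)`. -/

namespace MML

/-! ### Moments, deviations and limits of empirical means. -/

/-- `X` is a sequence of independent samples with law `P`. -/
structure IsIIDSample {Ω 𝒳 : Type*} [MeasurableSpace Ω] [MeasurableSpace 𝒳]
    (X : ℕ → Ω → 𝒳) (P : Measure 𝒳) (μ : Measure Ω) : Prop where
  measurable : ∀ n, Measurable (X n)
  indep : iIndepFun X μ
  map_eq : ∀ n, μ.map (X n) = P

/-- The empirical mean of `g` over the first `N` samples. -/
noncomputable def empMean {Ω 𝒳 : Type*} (X : ℕ → Ω → 𝒳) (N : ℕ) (g : 𝒳 → ℝ) (ω : Ω) : ℝ :=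
  (∑ n ∈ Finset.range N, g (X n ω)) / N

section EmpiricalMean

variable {Ω 𝒳 : Type*} {X : ℕ → Ω → 𝒳}

lemma empMean_sub (N : ℕ) (g h : 𝒳 → ℝ) (ω : Ω) :
    empMean X N (fun x => g x - h x) ω = empMean X N g ω - empMean X N h ω := by
  simp [empMean, Finset.sum_sub_distrib, sub_div]

lemma empMean_add (N : ℕ) (g h : 𝒳 → ℝ) (ω : Ω) :
    empMean X N (fun x => g x + h x) ω = empMean X N g ω + empMean X N h ω := by
  simp [empMean, Finset.sum_add_distrib, add_div]

lemma empMean_const_mul (N : ℕ) (c : ℝ) (g : 𝒳 → ℝ) (ω : Ω) :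
    empMean X N (fun x => c * g x) ω = c * empMean X N g ω := by
  simp [empMean, ← Finset.mul_sum, mul_div_assoc]

lemma empMean_const {N : ℕ} (hN : N ≠ 0) (c : ℝ) (ω : Ω) :
    empMean X N (fun _ => c) ω = c := by
  simp [empMean, hN]

lemma empMean_mono {N : ℕ} {g h : 𝒳 → ℝ} {ω : Ω} (hgh : ∀ n, g (X n ω) ≤ h (X n ω)) :
    empMean X N g ω ≤ empMean X N h ω := by
  unfold empMean
  gcongr
  exact hgh _

lemma abs_empMean_le {N : ℕ} {g h : 𝒳 → ℝ} {ω : Ω} (hgh : ∀ n, |g (X n ω)| ≤ h (X n ω)) :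
    |empMean X N g ω| ≤ empMean X N h ω := by
  unfold empMean
  rw [abs_div, Nat.abs_cast]
  gcongr
  exact (Finset.abs_sum_le_sum_abs _ _).trans (Finset.sum_le_sum fun n _ => hgh n)

variable [MeasurableSpace Ω] [MeasurableSpace 𝒳] {P : Measure 𝒳} {μ : Measure Ω}

namespace IsIIDSample

lemma measurePreserving (h : IsIIDSample X P μ) (n : ℕ) : MeasurePreserving (X n) μ P :=
  ⟨h.measurable n, h.map_eq n⟩

lemma ae_forall (h : IsIIDSample X P μ) {p : 𝒳 → Prop} (hp : ∀ᵐ x ∂P, p x) :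
    ∀ᵐ ω ∂μ, ∀ n, p (X n ω) :=
  ae_all_iff.2 fun n => (h.measurePreserving n).quasiMeasurePreserving.ae hp

lemma aestronglyMeasurable_empMean (h : IsIIDSample X P μ) {g : 𝒳 → ℝ}
    (hg : AEStronglyMeasurable g P) (N : ℕ) : AEStronglyMeasurable (empMean X N g) μ := by
  unfold empMean
  simp_rw [div_eq_mul_inv]
  refine AEStronglyMeasurable.mul_const ?_ _
  have := Finset.aestronglyMeasurable_sum (μ := μ) (Finset.range N)
    (f := fun n ω => g (X n ω)) fun n _ =>
    hg.comp_measurePreserving (h.measurePreserving n)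
  simpa [Finset.sum_fn] using this

lemma memLp_empMean (h : IsIIDSample X P μ) {g : 𝒳 → ℝ}
    (hg : MemLp g 2 P) (N : ℕ) : MemLp (empMean X N g) 2 μ := by
  unfold empMean
  simp_rw [div_eq_mul_inv]
  exact (memLp_finsetSum (Finset.range N) fun n _ =>
    hg.comp_measurePreserving (h.measurePreserving n)).mul_const _

lemma iIndepFun_comp (h : IsIIDSample X P μ) {g : 𝒳 → ℝ}
    (hg : AEStronglyMeasurable g P) : iIndepFun (fun n => g ∘ X n) μ :=
  h.indep.comp₀ (fun _ => g) (fun n => (h.measurable n).aemeasurable)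
    fun n => (h.map_eq n).symm ▸ hg.aemeasurable

lemma integral_comp (h : IsIIDSample X P μ) {g : 𝒳 → ℝ}
    (hg : AEStronglyMeasurable g P) (n : ℕ) : ∫ ω, g (X n ω) ∂μ = ∫ x, g x ∂P := by
  rw [← h.map_eq n, integral_map (h.measurable n).aemeasurable ((h.map_eq n).symm ▸ hg)]

/-- The second moment of the empirical mean of a centred function. -/
lemma mul_integral_sq_empMean [IsProbabilityMeasure μ] (h : IsIIDSample X P μ) {g : 𝒳 → ℝ}
    (hg : MemLp g 2 P) (h0 : ∫ x, g x ∂P = 0) {N : ℕ} (hN : N ≠ 0) :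
    N * ∫ ω, empMean X N g ω ^ 2 ∂μ = ∫ x, g x ^ 2 ∂P := by
  have hL : ∀ n, MemLp (g ∘ X n) 2 μ := fun n =>
    hg.comp_measurePreserving (h.measurePreserving n)
  have hmean : ∀ n, ∫ ω, (g ∘ X n) ω ∂μ = 0 := fun n =>
    (h.integral_comp hg.aestronglyMeasurable n).trans h0
  have hv : ∀ n, variance (g ∘ X n) μ = ∫ x, g x ^ 2 ∂P := fun n => by
    rw [variance_of_integral_eq_zero (hL n).aemeasurable (hmean n)]
    exact h.integral_comp (g := fun x => g x ^ 2) (hg.aestronglyMeasurable.pow 2) n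
  have hs := IndepFun.variance_sum (μ := μ) (s := Finset.range N) (X := fun n => g ∘ X n)
    (fun n _ => hL n) (fun i _ j _ hij =>
      (h.iIndepFun_comp hg.aestronglyMeasurable).indepFun hij)
  rw [variance_of_integral_eq_zero (memLp_finsetSum' _ fun n _ => hL n).aemeasurable] at hs
  · simp only [hv, Finset.sum_const, Finset.card_range, nsmul_eq_mul] at hs
    have hN' : (N : ℝ) ≠ 0 := Nat.cast_ne_zero.2 hN
    simp only [empMean, div_pow, integral_div]
    simp only [Finset.sum_apply, Function.comp] at hs
    rw [hs]
    field_simp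
  · simp only [Finset.sum_apply]
    rw [integral_finsetSum _ fun n _ => (hL n).integrable one_le_two]
    exact Finset.sum_eq_zero fun n _ => hmean n

lemma mul_integral_sq_empMean_le [IsProbabilityMeasure μ] (h : IsIIDSample X P μ) {g : 𝒳 → ℝ}
    (hg : MemLp g 2 P) (h0 : ∫ x, g x ∂P = 0) (N : ℕ) :
    N * ∫ ω, empMean X N g ω ^ 2 ∂μ ≤ ∫ x, g x ^ 2 ∂P := by
  rcases eq_or_ne N 0 with rfl | hN
  · simpa using integral_nonneg fun x => sq_nonneg (g x)
  · exact (h.mul_integral_sq_empMean hg h0 hN).le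

end IsIIDSample

/-- One of the two exponentials is `exp |x|`, whose series contains `|x|⁴ / 4!`. This converts
sub-Gaussian bounds into a fourth moment bound. -/
lemma pow_four_le_exp_add_exp (x : ℝ) : x ^ 4 ≤ 24 * (Real.exp x + Real.exp (-x)) := by
  have key : |x| ^ 4 / 24 ≤ Real.exp |x| := by
    simpa [Nat.factorial] using Real.pow_div_factorial_le_exp |x| (abs_nonneg x) 4
  have h4 : |x| ^ 4 = x ^ 4 := (even_two_mul 2).pow_abs x
  have h1 := Real.exp_pos x
  have h2 := Real.exp_pos (-x)
  rcases abs_cases x with ⟨hx, -⟩ | ⟨hx, -⟩ <;> rw [h4, hx] at key <;> linarith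

namespace IsIIDSample

/-- The fourth moment of the empirical mean of a bounded centred function. -/
lemma exists_fourth_moment_le [IsProbabilityMeasure μ] (h : IsIIDSample X P μ) {g : 𝒳 → ℝ}
    (hg : Measurable g) {K : ℝ} (hK : ∀ x, |g x| ≤ K) (h0 : ∫ x, g x ∂P = 0) :
    ∃ C : ℝ, 0 ≤ C ∧ ∀ N : ℕ, Integrable (fun ω => (√N * empMean X N g ω) ^ 4) μ ∧
      ∫ ω, (√N * empMean X N g ω) ^ 4 ∂μ ≤ C := by
  set c : NNReal := (‖K - -K‖₊ / 2) ^ 2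
  have hmean : ∀ n, ∫ ω, (g ∘ X n) ω ∂μ = 0 := fun n =>
    (h.integral_comp hg.aestronglyMeasurable n).trans h0
  have hsub : ∀ n, HasSubgaussianMGF (g ∘ X n) c μ := fun n =>
    hasSubgaussianMGF_of_mem_Icc_of_integral_eq_zero (hg.comp (h.measurable n)).aemeasurable
      (.of_forall fun ω => abs_le.1 (hK _)) (hmean n)
  have hsum : ∀ N, HasSubgaussianMGF (fun ω => ∑ n ∈ Finset.range N, (g ∘ X n) ω)
      (∑ n ∈ Finset.range N, c) μ := fun N =>
    HasSubgaussianMGF.sum_of_iIndepFun (h.iIndepFun_comp hg.aestronglyMeasurable)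
      fun n _ => hsub n
  -- By Hoeffding's lemma the sum has sub-Gaussian parameter `N c`, so at `±1/√N` its moment
  -- generating function is at most `exp (c / 2)`, whatever `N`.
  refine ⟨24 * (Real.exp (c / 2) + Real.exp (c / 2)), by positivity, fun N => ?_⟩
  set S : Ω → ℝ := fun ω => ∑ n ∈ Finset.range N, (g ∘ X n) ω
  have hZ : ∀ ω, √N * empMean X N g ω = (√N)⁻¹ * S ω := fun ω => by
    rcases eq_or_ne N 0 with rfl | hN
    · simp
    · have hN' : (0 : ℝ) < N := by positivity
      have : √(N : ℝ) * √N = N := Real.mul_self_sqrt hN'.le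
      have hs : √(N : ℝ) ≠ 0 := by positivity
      simp only [empMean, S, Function.comp]
      field_simp
      rw [sq, this, mul_comm]
  have hi : ∀ t, Integrable (fun ω => Real.exp (t * S ω)) μ := (hsum N).integrable_exp_mul
  have hle : ∀ t : ℝ, t ^ 2 = (N : ℝ)⁻¹ → ∫ ω, Real.exp (t * S ω) ∂μ ≤ Real.exp (c / 2) := by
    intro t ht
    refine ((hsum N).mgf_le t).trans (Real.exp_le_exp.2 ?_)
    rw [ht]
    rcases eq_or_ne N 0 with rfl | hN
    · simpa using by positivity
    · simp
      field_simp
      rfl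
  have hsq : ((√(N : ℝ))⁻¹) ^ 2 = (N : ℝ)⁻¹ := by
    rw [inv_pow, Real.sq_sqrt (Nat.cast_nonneg N)]
  have hdom : Integrable (fun ω => 24 * (Real.exp ((√N)⁻¹ * S ω) +
      Real.exp (-(√N)⁻¹ * S ω))) μ := ((hi _).add (hi _)).const_mul 24
  have hpt : ∀ ω, (√N * empMean X N g ω) ^ 4 ≤ 24 * (Real.exp ((√N)⁻¹ * S ω) +
      Real.exp (-(√N)⁻¹ * S ω)) := fun ω => by
    rw [hZ, neg_mul]
    exact pow_four_le_exp_add_exp _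
  have hint : Integrable (fun ω => (√N * empMean X N g ω) ^ 4) μ := by
    refine hdom.mono' (((h.aestronglyMeasurable_empMean hg.aestronglyMeasurable N).const_mul
      _).pow 4) (.of_forall fun ω => ?_)
    rw [Real.norm_of_nonneg (by positivity)]
    exact hpt ω
  refine ⟨hint, (integral_mono hint hdom hpt).trans ?_⟩
  rw [integral_const_mul, integral_add (hi _) (hi _)]
  gcongr
  · exact hle _ hsq
  · exact hle _ (by rw [neg_sq, hsq])

/-- Uniform integrability of the squares of the normalized sums of a centred function. -/
lemma tendsto_mul_setIntegral_sq_empMean [IsProbabilityMeasure μ] [IsProbabilityMeasure P]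
    (h : IsIIDSample X P μ) {g : 𝒳 → ℝ} (hg : MemLp g 2 P) (h0 : ∫ x, g x ∂P = 0)
    {E : ℕ → Set Ω} (hlim : Tendsto (fun N => μ.real (E N)) atTop (𝓝 0)) :
    Tendsto (fun N : ℕ => N * ∫ ω in E N, empMean X N g ω ^ 2 ∂μ) atTop (𝓝 0) := by
  have hnn : ∀ N : ℕ, 0 ≤ N * ∫ ω in E N, empMean X N g ω ^ 2 ∂μ := fun N =>
    mul_nonneg (Nat.cast_nonneg _) (integral_nonneg fun ω => sq_nonneg _)
  refine tendsto_order.2 ⟨fun a ha => .of_forall fun N => ha.trans_le (hnn N), fun ε hε => ?_⟩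
  -- approximate `g` by a bounded centred function
  obtain ⟨s, hs, hsL⟩ := hg.exists_simpleFunc_eLpNorm_sub_lt ENNReal.ofNat_ne_top
    (ε := ENNReal.ofReal √(ε / 8)) (by simp [Real.sqrt_pos, hε])
  set m := ∫ x, s x ∂P
  set g₁ : 𝒳 → ℝ := fun x => s x - m
  set g₂ : 𝒳 → ℝ := fun x => g x - g₁ x
  have hsi : Integrable s P := hsL.integrable one_le_two
  have hgi : Integrable g P := hg.integrable one_le_two
  have hg₁L : MemLp g₁ 2 P := hsL.sub (memLp_const m)
  have hg₂L : MemLp g₂ 2 P := hg.sub hg₁L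
  have hg₁0 : ∫ x, g₁ x ∂P = 0 := by
    simp only [g₁]
    rw [integral_sub hsi (integrable_const m)]
    simp [m]
  have hg₂0 : ∫ x, g₂ x ∂P = 0 := by
    simp only [g₂]
    rw [integral_sub hgi (hg₁L.integrable one_le_two), h0, hg₁0, sub_zero]
  -- As `g` is centred, `g₂` is `g - s` minus its mean, so its second moment is a variance and
  -- recentring costs nothing.
  have hg₂sq : ∫ x, g₂ x ^ 2 ∂P ≤ ε / 8 := by
    have hd : MemLp (fun x => g x - s x) 2 P := hg.sub hsL
    have h1 : ∫ x, g₂ x ^ 2 ∂P ≤ ∫ x, (g x - s x) ^ 2 ∂P := by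
      have hdm : ∫ x, (g x - s x) ∂P = -m := by
        rw [integral_sub hgi hsi, h0, zero_sub]
      have : ∫ x, g₂ x ^ 2 ∂P = variance (fun x => g x - s x) P := by
        rw [variance_eq_integral hd.aemeasurable, hdm]
        refine integral_congr_ae (.of_forall fun x => ?_)
        simp only [g₂, g₁]
        ring
      rw [this]
      exact variance_le_expectation_sq hd.aestronglyMeasurable
    refine h1.trans ?_
    have h2 : ENNReal.ofReal (∫ x, (g x - s x) ^ 2 ∂P) =
        eLpNorm (fun x => g x - s x) 2 P ^ 2 := by
      rw [hd.eLpNorm_eq_integral_rpow_norm two_ne_zero ENNReal.ofNat_ne_top,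
        ← ENNReal.ofReal_pow (by positivity)]
      congr 1
      simp only [ENNReal.toReal_ofNat, Real.rpow_two, Real.norm_eq_abs, sq_abs]
      rw [← Real.rpow_mul_natCast (integral_nonneg fun x => sq_nonneg _)]
      norm_num
    have h3 : ENNReal.ofReal (∫ x, (g x - s x) ^ 2 ∂P) ≤ ENNReal.ofReal (ε / 8) := by
      rw [h2, ← Real.sq_sqrt (show 0 ≤ ε / 8 by positivity),
        ENNReal.ofReal_pow (Real.sqrt_nonneg _)]
      exact pow_le_pow_left' hs.le 2
    exact (ENNReal.ofReal_le_ofReal_iff (by positivity)).1 h3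
  obtain ⟨K, hK⟩ := s.exists_forall_norm_le
  obtain ⟨C, hC0, hC⟩ := h.exists_fourth_moment_le (g := g₁) (K := K + |m|)
    (s.measurable.sub_const m) (fun x => (abs_sub _ _).trans (add_le_add_left (hK x) _)) hg₁0
  -- By `z² ≤ T + z⁴ / T`, the bounded part contributes at most `T μ(E) + C / T`: `T` makes the
  -- second term small, then large `N` the first.
  obtain ⟨T, hT0, hCT⟩ : ∃ T : ℝ, 0 < T ∧ C / T ≤ ε / 8 := by
    refine ⟨8 * (C + 1) / ε, by positivity, ?_⟩
    rw [div_le_iff₀ (by positivity)]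
    field_simp
    linarith
  have hev : ∀ᶠ N in atTop, μ.real (E N) < ε / (8 * T) :=
    hlim.eventually (gt_mem_nhds (by positivity))
  filter_upwards [hev] with N hN
  have hI₂ := (h.memLp_empMean hg₂L N).integrable_sq
  have hI := (h.memLp_empMean hg N).integrable_sq
  have hpt : ∀ ω, N * empMean X N g ω ^ 2 ≤ 2 * (N * empMean X N g₂ ω ^ 2) +
      2 * (T + (√N * empMean X N g₁ ω) ^ 4 / T) := fun ω => by
    have e1 : empMean X N g ω = empMean X N g₂ ω + empMean X N g₁ ω := by
      rw [← empMean_add]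
      simp [g₂]
    have e2 : (N : ℝ) * empMean X N g₁ ω ^ 2 = (√N * empMean X N g₁ ω) ^ 2 := by
      rw [mul_pow, Real.sq_sqrt (Nat.cast_nonneg N)]
    have e3 : ∀ z : ℝ, z ^ 2 ≤ T + z ^ 4 / T := fun z => by
      rw [← sub_nonneg]
      have : T + z ^ 4 / T - z ^ 2 = ((T - z ^ 2 / 2) ^ 2 + 3 / 4 * z ^ 4) / T := by
        field_simp
        ring
      rw [this]
      positivity
    have e4 := e3 (√N * empMean X N g₁ ω)
    rw [← e2] at e4
    have e5 : (N : ℝ) * empMean X N g ω ^ 2 ≤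
        2 * (N * empMean X N g₂ ω ^ 2) + 2 * (N * empMean X N g₁ ω ^ 2) := by
      rw [e1]
      have : (0 : ℝ) ≤ N * (empMean X N g₂ ω - empMean X N g₁ ω) ^ 2 := by positivity
      nlinarith
    linarith
  calc N * ∫ ω in E N, empMean X N g ω ^ 2 ∂μ
      = ∫ ω in E N, N * empMean X N g ω ^ 2 ∂μ := (integral_const_mul _ _).symm
    _ ≤ ∫ ω in E N, (2 * (N * empMean X N g₂ ω ^ 2) +
          2 * (T + (√N * empMean X N g₁ ω) ^ 4 / T)) ∂μ := by
        refine integral_mono (hI.const_mul _).integrableOn ?_ hpt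
        exact (((hI₂.const_mul _).const_mul _).add
          (((integrable_const T).add ((hC N).1.div_const T)).const_mul 2)).integrableOn
    _ = 2 * (N * ∫ ω in E N, empMean X N g₂ ω ^ 2 ∂μ) +
          2 * (T * μ.real (E N) + (∫ ω in E N, (√N * empMean X N g₁ ω) ^ 4 ∂μ) / T) := by
        have i₁ : Integrable (fun ω => (2 : ℝ) * (N * empMean X N g₂ ω ^ 2))
          (μ.restrict (E N)) := ((hI₂.const_mul _).const_mul _).integrableOn
        have i₂ : Integrable (fun ω => (√N * empMean X N g₁ ω) ^ 4 / T)
          (μ.restrict (E N)) := ((hC N).1.div_const T).integrableOn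
        have i₃ : Integrable (fun ω => 2 * (T + (√N * empMean X N g₁ ω) ^ 4 / T))
          (μ.restrict (E N)) := ((integrable_const T).add i₂).const_mul 2
        rw [integral_add i₁ i₃, integral_const_mul, integral_const_mul, integral_const_mul,
          integral_add (integrable_const T) i₂, integral_div, setIntegral_const, smul_eq_mul,
          mul_comm (μ.real (E N)) T]
    _ ≤ 2 * (N * ∫ ω, empMean X N g₂ ω ^ 2 ∂μ) +
          2 * (T * μ.real (E N) + (∫ ω, (√N * empMean X N g₁ ω) ^ 4 ∂μ) / T) := by
        gcongr
        · exact .of_forall fun ω => sq_nonneg _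
        · exact Measure.restrict_le_self
        · exact .of_forall fun ω => by positivity
        · exact (hC N).1
        · exact Measure.restrict_le_self
    _ ≤ 2 * (ε / 8) + 2 * (T * μ.real (E N) + C / T) := by
        gcongr
        · exact (h.mul_integral_sq_empMean_le hg₂L hg₂0 N).trans hg₂sq
        · exact (hC N).2
    _ < ε := by
        have : T * μ.real (E N) < ε / 8 := by
          rw [lt_div_iff₀ (by positivity)] at hN ⊢
          linarith
        linarith

/-- Deviations of empirical means of square integrable functions have probability `o(1/N)`. -/
lemma tendsto_mul_measureReal_deviation [IsProbabilityMeasure μ] [IsProbabilityMeasure P]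
    (h : IsIIDSample X P μ) {g : 𝒳 → ℝ} (hg : MemLp g 2 P) {c : ℝ} (hc : 0 < c) :
    Tendsto (fun N : ℕ => N * μ.real {ω | c ≤ |empMean X N g ω - ∫ x, g x ∂P|}) atTop (𝓝 0) := by
  set g₀ : 𝒳 → ℝ := fun x => g x - ∫ y, g y ∂P
  have hg₀ : MemLp g₀ 2 P := hg.sub (memLp_const _)
  have h0 : ∫ x, g₀ x ∂P = 0 := by
    simp only [g₀]
    rw [integral_sub (hg.integrable one_le_two) (integrable_const _)]
    simp
  have hEeq : ∀ᶠ N : ℕ in atTop, {ω | c ≤ |empMean X N g ω - ∫ x, g x ∂P|} =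
      {ω | c ≤ |empMean X N g₀ ω|} := by
    filter_upwards [eventually_ne_atTop 0] with N hN
    ext ω
    simp only [g₀, empMean_sub, empMean_const hN]
  suffices Tendsto (fun N : ℕ => N * μ.real {ω | c ≤ |empMean X N g₀ ω|}) atTop (𝓝 0) by
    refine this.congr' ?_
    filter_upwards [hEeq] with N hN
    rw [hN]
  have hE : ∀ N, NullMeasurableSet {ω | c ≤ |empMean X N g₀ ω|} μ := fun N =>
    nullMeasurableSet_le aemeasurable_const
      (h.aestronglyMeasurable_empMean hg₀.aestronglyMeasurable N).aemeasurable.abs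
  have hI : ∀ N, Integrable (fun ω => empMean X N g₀ ω ^ 2) μ := fun N =>
    (h.memLp_empMean hg₀ N).integrable_sq
  have hcheb : ∀ N : ℕ, c ^ 2 * μ.real {ω | c ≤ |empMean X N g₀ ω|} ≤
      ∫ ω in {ω | c ≤ |empMean X N g₀ ω|}, empMean X N g₀ ω ^ 2 ∂μ := fun N => by
    have : ∫ ω in {ω | c ≤ |empMean X N g₀ ω|}, c ^ 2 ∂μ ≤
        ∫ ω in {ω | c ≤ |empMean X N g₀ ω|}, empMean X N g₀ ω ^ 2 ∂μ := by
      refine setIntegral_mono_on₀ (integrable_const _).integrableOn (hI N).integrableOn (hE N)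
        fun ω hω => ?_
      rw [← sq_abs (empMean X N g₀ ω)]
      exact pow_le_pow_left₀ hc.le hω 2
    simpa [mul_comm] using this
  -- Chebyshev on the whole space shows that these events are asymptotically negligible; uniform
  -- integrability on the same events then upgrades `O(1/N)` to `o(1/N)`.
  have hlim : Tendsto (fun N => μ.real {ω | c ≤ |empMean X N g₀ ω|}) atTop (𝓝 0) := by
    refine squeeze_zero' (.of_forall fun N => measureReal_nonneg)
      (g := fun N : ℕ => (∫ x, g₀ x ^ 2 ∂P) / c ^ 2 / N) ?_
      (tendsto_const_div_atTop_nhds_zero_nat _)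
    filter_upwards [eventually_ne_atTop 0] with N hN
    have hN' : (0 : ℝ) < N := by positivity
    rw [← h.mul_integral_sq_empMean hg₀ h0 hN, le_div_iff₀ hN', le_div_iff₀ (by positivity)]
    have := (hcheb N).trans (setIntegral_le_integral (hI N) (.of_forall fun ω => sq_nonneg _))
    nlinarith
  have := (h.tendsto_mul_setIntegral_sq_empMean hg₀ h0 hlim).div_const (c ^ 2)
  rw [zero_div] at this
  refine squeeze_zero (fun N => by positivity) (fun N => ?_) this
  rw [le_div_iff₀ (by positivity), mul_assoc]
  gcongr
  rw [mul_comm]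
  exact hcheb N

/-- The strong law of large numbers for empirical means. -/
lemma ae_tendsto_empMean [IsProbabilityMeasure μ] (h : IsIIDSample X P μ) {g : 𝒳 → ℝ}
    (hg : Integrable g P) :
    ∀ᵐ ω ∂μ, Tendsto (fun N => empMean X N g ω) atTop (𝓝 (∫ x, g x ∂P)) := by
  have hm := hg.aestronglyMeasurable
  have := strong_law_ae_real (μ := μ) (fun n => g ∘ X n)
    ((h.measurePreserving 0).integrable_comp_of_integrable hg)
    (fun i j hij => (h.iIndepFun_comp hm).indepFun hij)
    (fun n => by
      refine IdentDistrib.comp_of_aemeasurable (f := X n) (g := X 0) (u := g)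
        ⟨(h.measurable n).aemeasurable, (h.measurable 0).aemeasurable, ?_⟩ ?_
      · rw [h.map_eq, h.map_eq]
      · rw [h.map_eq]; exact hm.aemeasurable)
  rw [show μ[g ∘ X 0] = ∫ x, g x ∂P from h.integral_comp hm 0] at this
  exact this

end IsIIDSample

end EmpiricalMean

end MML

namespace MML

/-! ### From a pathwise sandwich to the limit of scaled expectations. -/

section Sandwich

variable {Ω : Type*} [MeasurableSpace Ω] {μ : Measure Ω} [IsProbabilityMeasure μ]

/-- If the bounded variables `Y N` lie between `(S N)² / (a + η)²` and `(S N)² / (a - η)²` outside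
events of probability `o(1/N)`, then `N E[Y N]` has the same limit as `N E[(S N)²] / a²`. -/
lemma tendsto_mul_integral_of_sandwich {S Y : ℕ → Ω → ℝ} {B D a : ℝ} (ha : 0 < a)
    (hSi : ∀ N, Integrable (fun ω => S N ω ^ 2) μ)
    (hS : ∀ᶠ N : ℕ in atTop, N * ∫ ω, S N ω ^ 2 ∂μ = B)
    (hUI : ∀ E : ℕ → Set Ω, Tendsto (fun N => μ.real (E N)) atTop (𝓝 0) →
      Tendsto (fun N : ℕ => N * ∫ ω in E N, S N ω ^ 2 ∂μ) atTop (𝓝 0))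
    (hYi : ∀ N, Integrable (Y N) μ) (hY0 : ∀ N, ∀ᵐ ω ∂μ, 0 ≤ Y N ω)
    (hYD : ∀ N, ∀ᵐ ω ∂μ, Y N ω ≤ D)
    (hbad : ∀ η, 0 < η → η < a → ∃ E : ℕ → Set Ω,
      Tendsto (fun N : ℕ => N * μ.real (E N)) atTop (𝓝 0) ∧
      ∀ᶠ N in atTop, ∀ᵐ ω ∂μ, ω ∉ E N →
        S N ω ^ 2 / (a + η) ^ 2 ≤ Y N ω ∧ Y N ω ≤ S N ω ^ 2 / (a - η) ^ 2) :
    Tendsto (fun N : ℕ => N * ∫ ω, Y N ω ∂μ) atTop (𝓝 (B / a ^ 2)) := by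
  have hbad' : ∀ η, 0 < η → η < a → ∃ e e' : ℕ → ℝ, Tendsto e atTop (𝓝 0) ∧
      Tendsto e' atTop (𝓝 0) ∧ ∀ᶠ N : ℕ in atTop,
        (B - e N) / (a + η) ^ 2 ≤ N * ∫ ω, Y N ω ∂μ ∧
        N * ∫ ω, Y N ω ∂μ ≤ B / (a - η) ^ 2 + e' N := by
    intro η hη hηa
    obtain ⟨E, hE, hYE⟩ := hbad η hη hηa
    -- The events need not be measurable; their measurable hulls have the same measure.
    set E' : ℕ → Set Ω := fun N => toMeasurable μ (E N)
    have hE'm : ∀ N, MeasurableSet (E' N) := fun N => measurableSet_toMeasurable _ _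
    have hE'r : ∀ N, μ.real (E' N) = μ.real (E N) := fun N => by
      simp [E', measureReal_def]
    have hE0 : Tendsto (fun N => μ.real (E' N)) atTop (𝓝 0) := by
      refine squeeze_zero' (.of_forall fun N => measureReal_nonneg) ?_ hE
      filter_upwards [eventually_ge_atTop 1] with N hN
      rw [hE'r]
      exact le_mul_of_one_le_left measureReal_nonneg (by exact_mod_cast hN)
    -- The lower bound loses the mass of `S²` on the bad event, which uniform integrability
    -- controls; the upper bound gains at most `D` there.
    refine ⟨fun N => N * ∫ ω in E' N, S N ω ^ 2 ∂μ, fun N => D * (N * μ.real (E N)),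
      hUI E' hE0, by simpa using hE.const_mul D, ?_⟩
    filter_upwards [hS, hYE] with N hSN hYN
    have hN0 : (0 : ℝ) ≤ N := Nat.cast_nonneg N
    have hp : 0 < a - η := sub_pos.2 hηa
    constructor
    · have h1 : ∫ ω, S N ω ^ 2 ∂μ - ∫ ω in E' N, S N ω ^ 2 ∂μ
          ≤ (a + η) ^ 2 * ∫ ω, Y N ω ∂μ := by
        rw [← integral_add_compl (hE'm N) (hSi N), add_sub_cancel_left, ← integral_const_mul,
          ← integral_indicator (hE'm N).compl]
        refine integral_mono_ae ((hSi N).indicator (hE'm N).compl) ((hYi N).const_mul _) ?_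
        filter_upwards [hYN, hY0 N] with ω h1 h2
        by_cases hω : ω ∈ E' N
        · rw [indicator_of_notMem (by simpa using hω)]
          positivity
        · rw [indicator_of_mem (by simpa using hω)]
          have := (h1 fun h => hω (subset_toMeasurable _ _ h)).1
          rwa [div_le_iff₀' (by positivity)] at this
      rw [div_le_iff₀ (by positivity), ← hSN, ← mul_sub]
      calc _ ≤ N * ((a + η) ^ 2 * ∫ ω, Y N ω ∂μ) := by gcongr
        _ = _ := by ring
    · have h1 : ∫ ω, Y N ω ∂μ ≤ (∫ ω, S N ω ^ 2 ∂μ) / (a - η) ^ 2 + D * μ.real (E' N) := by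
        have hind : D * μ.real (E' N) = ∫ ω, (E' N).indicator (fun _ => D) ω ∂μ := by
          rw [integral_indicator (hE'm N), setIntegral_const, smul_eq_mul, mul_comm]
        have hi : Integrable ((E' N).indicator fun _ => D) μ :=
          (integrable_const D).indicator (hE'm N)
        rw [hind, ← integral_div, ← integral_add ((hSi N).div_const _) hi]
        refine integral_mono_ae (hYi N) (((hSi N).div_const _).add hi) ?_
        filter_upwards [hYN, hYD N] with ω h1 h2
        by_cases hω : ω ∈ E' N
        · simp only [indicator_of_mem hω]
          have : 0 ≤ S N ω ^ 2 / (a - η) ^ 2 := by positivity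
          linarith
        · simp only [indicator_of_notMem hω, add_zero]
          exact (h1 fun h => hω (subset_toMeasurable _ _ h)).2
      rw [hE'r] at h1
      calc _ ≤ N * ((∫ ω, S N ω ^ 2 ∂μ) / (a - η) ^ 2 + D * μ.real (E N)) := by gcongr
        _ = _ := by rw [← hSN]; ring
  -- Both bounds tend to `B / a²` as `η → 0`; the signs `σ = 1` and `σ = -1` give the lower and the
  -- upper one.
  have hcont : ∀ σ : ℝ, Tendsto (fun η : ℝ => B / (a + σ * η) ^ 2) (𝓝[>] 0) (𝓝 (B / a ^ 2)) :=
    fun σ => by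
    have : ContinuousAt (fun η : ℝ => B / (a + σ * η) ^ 2) 0 := by
      refine ContinuousAt.div (by fun_prop) (by fun_prop) ?_
      simp [ha.ne']
    simpa using this.tendsto.mono_left nhdsWithin_le_nhds
  have hsmall : ∀ᶠ η : ℝ in 𝓝[>] 0, 0 < η ∧ η < a :=
    (eventually_mem_nhdsWithin.and (nhdsWithin_le_nhds (gt_mem_nhds ha)))
  refine tendsto_order.2 ⟨fun l hl => ?_, fun l hl => ?_⟩
  · obtain ⟨η, hη, h0, h1⟩ := (((hcont 1).eventually (lt_mem_nhds hl)).and hsmall).exists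
    obtain ⟨e, e', he, -, hN⟩ := hbad' η h0 h1
    have ht : Tendsto (fun N => (B - e N) / (a + η) ^ 2) atTop (𝓝 ((B - 0) / (a + η) ^ 2)) :=
      (he.const_sub B).div_const _
    rw [one_mul] at hη
    rw [sub_zero] at ht
    filter_upwards [hN, ht.eventually (lt_mem_nhds hη)] with N h2 h3
    exact h3.trans_le h2.1
  · obtain ⟨η, hη, h0, h1⟩ := (((hcont (-1)).eventually (gt_mem_nhds hl)).and hsmall).exists
    obtain ⟨e, e', -, he', hN⟩ := hbad' η h0 h1
    have ht := he'.const_add (B / (a - η) ^ 2)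
    rw [add_zero] at ht
    rw [neg_one_mul, ← sub_eq_add_neg] at hη
    filter_upwards [hN, ht.eventually (gt_mem_nhds hη)] with N h2 h3
    exact h2.2.trans_lt h3

end Sandwich

/-! ### Deterministic one-variable estimates. -/

section RealLemmas

/-- The parabola `ε s - c ε²` is nonnegative exactly between its roots; the unordered interval
treats both signs of `s` at once. -/
lemma mem_uIcc_zero_div_iff {c s ε : ℝ} (hc : 0 < c) :
    ε ∈ uIcc 0 (s / c) ↔ c * ε ^ 2 ≤ ε * s := by
  rw [mem_uIcc, le_div_iff₀ hc, div_le_iff₀ hc]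
  constructor
  · rintro (⟨h1, h2⟩ | ⟨h1, h2⟩) <;> nlinarith
  · intro h
    rcases lt_trichotomy ε 0 with h0 | rfl | h0
    · exact .inr ⟨by nlinarith, h0.le⟩
    · rcases le_total 0 s with hs | hs
      · exact .inl ⟨le_rfl, by simpa using hs⟩
      · exact .inr ⟨by simpa using hs, le_rfl⟩
    · exact .inl ⟨h0.le, by nlinarith⟩

lemma setIntegral_abs_uIcc_zero (r : ℝ) : ∫ ε in uIcc 0 r, |ε| = r ^ 2 / 2 := by
  rcases le_total 0 r with hr | hr
  · rw [uIcc_of_le hr, integral_Icc_eq_integral_Ioc, ← intervalIntegral.integral_of_le hr,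
      intervalIntegral.integral_congr (g := fun x => x)]
    · simp
    · intro x hx
      rw [uIcc_of_le hr] at hx
      exact abs_of_nonneg hx.1
  · rw [uIcc_of_ge hr, integral_Icc_eq_integral_Ioc, ← intervalIntegral.integral_of_le hr,
      intervalIntegral.integral_congr (g := fun x => -x)]
    · rw [intervalIntegral.integral_neg, integral_id]
      ring
    · intro x hx
      rw [uIcc_of_le hr] at hx
      exact abs_of_nonpos hx.2

/-- Where a function is squeezed between two downward parabolas, the weighted size of the set on
which it is nonnegative is explicit. -/
lemma setIntegral_abs_nonneg_set_bounds {d : ℝ → ℝ} {T : Set ℝ} {α β a η δ s : ℝ}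
    (hη : 0 < η) (hηa : η < a) (hα : α ≤ -δ) (hβ : δ ≤ β) (hs : 2 * |s| ≤ a * δ)
    (hTd : ∀ ε ∈ Icc (α / 2) (β / 2), ε ∈ T ↔ 0 ≤ d (2 * ε))
    (hfar : ∀ u ∈ Icc α β, δ < |u| → d u < 0)
    (hnear : ∀ u, |u| ≤ δ → |d u - u * s + a * u ^ 2 / 2| ≤ η * u ^ 2 / 2) :
    s ^ 2 / (a + η) ^ 2 ≤ 2 * ∫ ε in Icc (α / 2) (β / 2) ∩ T, |ε| ∧
      2 * ∫ ε in Icc (α / 2) (β / 2) ∩ T, |ε| ≤ s ^ 2 / (a - η) ^ 2 := by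
  have hp : 0 < a - η := sub_pos.2 hηa
  have hq : 0 < a + η := by linarith
  -- Both bounds become integrals of `|ε|` over intervals, so only set inclusions remain. At `u =
  -- 2ε` the bounding parabolas are `2 (ε s - (a ± η) ε²)`.
  have key : ∀ r : ℝ, s ^ 2 / r ^ 2 = 2 * ∫ ε in uIcc 0 (s / r), |ε| := fun r => by
    rw [setIntegral_abs_uIcc_zero]
    ring
  have hint : ∀ {u v : ℝ}, IntegrableOn (fun ε : ℝ => |ε|) (Icc u v) := fun {u v} =>
    continuous_abs.integrableOn_Icc
  have hnn : ∀ t : Set ℝ, 0 ≤ᵐ[volume.restrict t] fun ε : ℝ => |ε| := fun t =>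
    .of_forall fun ε => abs_nonneg ε
  have hδ : 0 ≤ δ := by
    have := abs_nonneg s
    by_contra! h
    nlinarith
  rw [key, key]
  constructor
  · refine mul_le_mul_of_nonneg_left (setIntegral_mono_set (hint.mono_set inter_subset_left)
      (hnn _) (LE.le.eventuallyLE ?_)) zero_le_two
    intro ε hε
    have h1 := (mem_uIcc_zero_div_iff hq).1 hε
    -- The assumption `2 |s| ≤ a δ` keeps the whole interval inside the region where the expansion
    -- is valid.
    have hle : |2 * ε| ≤ δ := by
      have h2 : |ε| ≤ |s / (a + η)| := by
        rcases mem_uIcc.1 hε with ⟨h3, h4⟩ | ⟨h3, h4⟩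
        · rwa [abs_of_nonneg h3, abs_of_nonneg (h3.trans h4)]
        · rw [abs_of_nonpos h4, abs_of_nonpos (h3.trans h4)]
          exact neg_le_neg h3
      rw [abs_div, abs_of_pos hq, le_div_iff₀ hq] at h2
      rw [abs_mul, abs_two]
      have := abs_nonneg ε
      nlinarith
    have hIcc : ε ∈ Icc (α / 2) (β / 2) := by
      have := abs_le.1 hle
      constructor <;> linarith
    refine ⟨hIcc, (hTd ε hIcc).2 ?_⟩
    have := (abs_le.1 (hnear _ hle)).1
    nlinarith
  · refine mul_le_mul_of_nonneg_left (setIntegral_mono_set hint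
      (hnn _) (LE.le.eventuallyLE ?_)) zero_le_two
    rintro ε ⟨hIcc, hεT⟩
    have h0 := (hTd ε hIcc).1 hεT
    rw [mem_uIcc_zero_div_iff hp]
    have hle : |2 * ε| ≤ δ := by
      by_contra! h
      exact (hfar _ ⟨by linarith [hIcc.1], by linarith [hIcc.2]⟩ h).not_ge h0
    have := (abs_le.1 (hnear _ hle)).2
    nlinarith

/-- An approximate root of a linear equation. -/
lemma sq_bounds_of_abs_sub_le {a η s u : ℝ} (hη : 0 < η) (hηa : η < a)
    (h : |s - a * u| ≤ η * |u|) : s ^ 2 / (a + η) ^ 2 ≤ u ^ 2 ∧ u ^ 2 ≤ s ^ 2 / (a - η) ^ 2 := by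
  have hp : 0 < a - η := sub_pos.2 hηa
  have hq : 0 < a + η := by linarith
  have hau : |a * u| = a * |u| := by rw [abs_mul, abs_of_pos (hη.trans hηa)]
  have h1 : |s| ≤ (a + η) * |u| := by
    have := abs_sub_abs_le_abs_sub s (a * u)
    linarith
  have h2 : (a - η) * |u| ≤ |s| := by
    have := abs_sub_abs_le_abs_sub (a * u) s
    rw [abs_sub_comm] at this
    linarith
  constructor
  · rw [div_le_iff₀ (by positivity), ← sq_abs s, ← sq_abs u, ← mul_pow, mul_comm]
    gcongr
  · rw [le_div_iff₀ (by positivity), ← sq_abs s, ← sq_abs u, ← mul_pow, mul_comm]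
    gcongr

/-- The mean value inequality on the segment from `t` to `θ`. The factor `1 / (k + 1)` of true
integration is given up: only the order of the Taylor remainders matters. -/
lemma abs_sub_le_of_hasDerivWithinAt_of_abs_le_pow {φ φ' : ℝ → ℝ} {s : Set ℝ} {t θ C : ℝ} {k : ℕ}
    (hs : s.OrdConnected) (ht : t ∈ s) (hθ : θ ∈ s) (hC : 0 ≤ C)
    (hφ : ∀ y ∈ s, HasDerivWithinAt φ (φ' y) s y)
    (hb : ∀ y ∈ s, |φ' y| ≤ C * |y - t| ^ k) : |φ θ - φ t| ≤ C * |θ - t| ^ (k + 1) := by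
  have hsub : uIcc t θ ⊆ s := hs.uIcc_subset ht hθ
  have := (convex_uIcc t θ).norm_image_sub_le_of_norm_hasDerivWithin_le (C := C * |θ - t| ^ k)
    (fun y hy => (hφ y (hsub hy)).mono hsub) (fun y hy => ?_) left_mem_uIcc right_mem_uIcc
  · rwa [Real.norm_eq_abs, Real.norm_eq_abs, mul_assoc, ← pow_succ] at this
  · refine (hb y (hsub hy)).trans ?_
    gcongr C * ?_ ^ k
    exact abs_sub_left_of_mem_uIcc hy

/-- A function bounded above by `0` near `0` with a second order expansion there. -/
lemma eq_zero_and_nonpos_of_expansion_nonpos {d : ℝ → ℝ} {s h R δ : ℝ} (hδ : 0 < δ)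
    (hd : ∀ u, |u| ≤ δ → d u ≤ 0)
    (hexp : ∀ u, |u| ≤ δ → |d u - u * s - u ^ 2 / 2 * h| ≤ R * |u| ^ 3) : s = 0 ∧ h ≤ 0 := by
  have hle : ∀ u, |u| ≤ δ → u * s + u ^ 2 / 2 * h ≤ R * |u| ^ 3 := fun u hu => by
    have := (abs_le.1 (hexp u hu)).1
    linarith [hd u hu]
  have hpos : ∀ᶠ u : ℝ in 𝓝[>] 0, 0 < u ∧ u ≤ δ :=
    eventually_mem_nhdsWithin.and (nhdsWithin_le_nhds (ge_mem_nhds hδ))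
  have lim : ∀ f : ℝ → ℝ, Continuous f → Tendsto f (𝓝[>] 0) (𝓝 (f 0)) := fun f hf =>
    (hf.tendsto 0).mono_left nhdsWithin_le_nhds
  -- Dividing by `u > 0` and letting `u → 0` on each side of the origin, `σ = ±1`, kills the linear
  -- term; division by `u² / 2` then gives the sign of `h`.
  have hs : s = 0 := by
    have side : ∀ σ : ℝ, |σ| = 1 → σ * s ≤ 0 := fun σ hσ => by
      have h0 := ge_of_tendsto (b := σ * s)
        (lim (fun u => R * u ^ 2 - u / 2 * h) (by fun_prop)) (by
          filter_upwards [hpos] with u ⟨hu, hu'⟩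
          have h1 := hle (σ * u) (by rwa [abs_mul, hσ, one_mul, abs_of_pos hu])
          have h2 : σ ^ 2 = 1 := by rw [← sq_abs, hσ, one_pow]
          rw [abs_mul, hσ, one_mul, abs_of_pos hu, mul_pow, h2] at h1
          refine le_of_mul_le_mul_left ?_ hu
          nlinarith)
      simpa using h0
    have h1 := side 1 (by simp)
    have h2 := side (-1) (by simp)
    linarith
  refine ⟨hs, ?_⟩
  have h0 := ge_of_tendsto (b := h) (lim (fun u => 2 * R * u) (by fun_prop)) (by
    filter_upwards [hpos] with u ⟨hu, hu'⟩
    have h1 := hle u (by rwa [abs_of_pos hu])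
    rw [hs, abs_of_pos hu] at h1
    refine le_of_mul_le_mul_left ?_ (show 0 < u ^ 2 / 2 by positivity)
    nlinarith)
  simpa using h0

end RealLemmas

end MML

namespace MML

/-! ### Regular models: Taylor bounds, measurability and separation. -/

section Model

variable {𝒳 : Type*}

/-- Positivity, smoothness and boundedness of the logarithmic density at one sample point. -/
structure RegularAt (f : 𝒳 → ℝ → ℝ) (a b : ℝ) (bd : ℕ → 𝒳 → ℝ) (x : 𝒳) : Prop where
  pos : ∀ θ ∈ Icc a b, 0 < f x θ
  contDiffOn : ContDiffOn ℝ 3 (fun θ => Real.log (f x θ)) (Icc a b)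
  bound : ∀ i ≤ 3, ∀ θ ∈ Icc a b, |dLog f a b i x θ| ≤ bd i x

/-- The regularity assumptions on a parametric family with parameter space `[a, b]`. -/
structure RegularModel [MeasurableSpace 𝒳] (P : Measure 𝒳) (f : 𝒳 → ℝ → ℝ) (a b : ℝ)
    (bd : ℕ → 𝒳 → ℝ) : Prop where
  lt : a < b
  measurable : ∀ θ ∈ Icc a b, Measurable fun x => f x θ
  regular : ∀ᵐ x ∂P, RegularAt f a b bd x
  memLp_bound : ∀ i ≤ 3, MemLp (bd i) 2 P

variable {f : 𝒳 → ℝ → ℝ} {a b : ℝ} {bd : ℕ → 𝒳 → ℝ} {x : 𝒳}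

lemma dLog_zero (θ : ℝ) : dLog f a b 0 x θ = Real.log (f x θ) := by
  simp [dLog]

namespace RegularAt

lemma hasDerivWithinAt_dLog (h : RegularAt f a b bd x) (hab : a < b) {i : ℕ} (hi : i < 3) {θ : ℝ}
    (hθ : θ ∈ Icc a b) :
    HasDerivWithinAt (dLog f a b i x) (dLog f a b (i + 1) x θ) (Icc a b) θ := by
  have := (h.contDiffOn.differentiableOn_iteratedDerivWithin (m := i) (by exact_mod_cast hi)
    (uniqueDiffOn_Icc hab)) θ hθ
  have := this.hasDerivWithinAt
  rwa [← iteratedDerivWithin_succ] at this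

lemma continuousOn (h : RegularAt f a b bd x) :
    ContinuousOn (fun θ => Real.log (f x θ)) (Icc a b) := h.contDiffOn.continuousOn

lemma bound_nonneg (h : RegularAt f a b bd x) (hab : a < b) {i : ℕ} (hi : i ≤ 3) : 0 ≤ bd i x :=
  (abs_nonneg _).trans (h.bound i hi a (left_mem_Icc.2 hab.le))

lemma abs_dLog_sub_le (h : RegularAt f a b bd x) (hab : a < b) {i : ℕ} (hi : i < 3) {t θ : ℝ}
    (ht : t ∈ Icc a b) (hθ : θ ∈ Icc a b) :
    |dLog f a b i x θ - dLog f a b i x t| ≤ bd (i + 1) x * |θ - t| := by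
  simpa using abs_sub_le_of_hasDerivWithinAt_of_abs_le_pow (k := 0) ordConnected_Icc ht hθ
    (h.bound_nonneg hab (i := i + 1) hi) (fun y hy => h.hasDerivWithinAt_dLog hab hi hy)
    (fun y hy => by simpa using h.bound (i + 1) hi y hy)

/-- The derivative of the remainder is an increment of the second derivative, already bounded by `bd
3 x * |θ - t|`; one more mean value inequality raises the power. The log-density itself is treated
likewise. -/
lemma abs_dLog_one_sub_le (h : RegularAt f a b bd x) (hab : a < b) {t θ : ℝ}
    (ht : t ∈ Icc a b) (hθ : θ ∈ Icc a b) :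
    |dLog f a b 1 x θ - dLog f a b 1 x t - (θ - t) * dLog f a b 2 x t| ≤ bd 3 x * |θ - t| ^ 2 := by
  have := abs_sub_le_of_hasDerivWithinAt_of_abs_le_pow (k := 1)
    (φ := fun y => dLog f a b 1 x y - (y - t) * dLog f a b 2 x t)
    (φ' := fun y => dLog f a b 2 x y - 1 * dLog f a b 2 x t) ordConnected_Icc ht hθ
    (h.bound_nonneg hab le_rfl)
    (fun y hy => (h.hasDerivWithinAt_dLog hab (by norm_num) hy).sub
      (((hasDerivWithinAt_id y _).sub_const t).mul_const _))
    (fun y hy => by simpa using h.abs_dLog_sub_le hab (i := 2) (by norm_num) ht hy)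
  convert this using 2
  ring

lemma abs_dLog_zero_sub_le (h : RegularAt f a b bd x) (hab : a < b) {t θ : ℝ}
    (ht : t ∈ Icc a b) (hθ : θ ∈ Icc a b) :
    |dLog f a b 0 x θ - dLog f a b 0 x t - (θ - t) * dLog f a b 1 x t
      - (θ - t) ^ 2 / 2 * dLog f a b 2 x t| ≤ bd 3 x * |θ - t| ^ 3 := by
  have := abs_sub_le_of_hasDerivWithinAt_of_abs_le_pow (k := 2)
    (φ := fun y => dLog f a b 0 x y - (y - t) * dLog f a b 1 x t
      - (y - t) ^ 2 / 2 * dLog f a b 2 x t)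
    (φ' := fun y => dLog f a b 1 x y - 1 * dLog f a b 1 x t
      - (2 * (y - t) ^ 1 * 1) / 2 * dLog f a b 2 x t) ordConnected_Icc ht hθ
    (h.bound_nonneg hab le_rfl)
    (fun y hy => ((h.hasDerivWithinAt_dLog hab (by norm_num) hy).sub
      (((hasDerivWithinAt_id y _).sub_const t).mul_const _)).sub
      (((((hasDerivWithinAt_id y _).sub_const t).pow 2).div_const 2).mul_const _))
    (fun y hy => by
      have := h.abs_dLog_one_sub_le hab ht hy
      convert this using 2
      ring)
  convert this using 2
  ring

end RegularAt

variable [MeasurableSpace 𝒳] {P : Measure 𝒳}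

lemma abs_integral_le_of_abs_le {g k : 𝒳 → ℝ} (hk : Integrable k P)
    (h : ∀ᵐ x ∂P, |g x| ≤ k x) : |∫ x, g x ∂P| ≤ ∫ x, k x ∂P :=
  (Real.norm_eq_abs _).symm.trans_le (norm_integral_le_of_norm_le hk h)

namespace RegularModel

/-- Measurability in `x` passes to derivatives as almost everywhere limits of difference quotients.
The quotients are taken from the right, hence the half-open interval. -/
lemma aestronglyMeasurable_dLog (h : RegularModel P f a b bd) {i : ℕ} (hi : i ≤ 3) :
    ∀ θ ∈ Ico a b, AEStronglyMeasurable (fun x => dLog f a b i x θ) P := by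
  induction i with
  | zero =>
    intro θ hθ
    simp_rw [dLog_zero]
    exact (h.measurable θ (Ico_subset_Icc_self hθ)).log.aestronglyMeasurable
  | succ i ih =>
    intro θ hθ
    -- Halving `b - θ` keeps every point strictly below `b`, where the induction hypothesis applies.
    have hlim : Tendsto (fun n : ℕ => θ + (b - θ) / 2 / ((n : ℝ) + 1)) atTop (𝓝[>] θ) := by
      refine tendsto_nhdsWithin_iff.2 ⟨?_, .of_forall fun n => ?_⟩
      · have := ((tendsto_const_div_atTop_nhds_zero_nat ((b - θ) / 2)).comp
          (tendsto_add_atTop_nat 1)).const_add θ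
        simpa using this
      · have : 0 < b - θ := sub_pos.2 hθ.2
        simp only [mem_Ioi]
        linarith [show 0 < (b - θ) / 2 / ((n : ℝ) + 1) by positivity]
    have hmem : ∀ n : ℕ, θ + (b - θ) / 2 / ((n : ℝ) + 1) ∈ Ico a b := fun n => by
      have h0 : 0 < b - θ := sub_pos.2 hθ.2
      have h1 : (b - θ) / 2 / ((n : ℝ) + 1) ≤ (b - θ) / 2 :=
        div_le_self (by positivity) (by linarith [Nat.cast_nonneg (α := ℝ) n])
      have h2 : 0 ≤ (b - θ) / 2 / ((n : ℝ) + 1) := by positivity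
      constructor <;> linarith [hθ.1]
    refine aestronglyMeasurable_of_tendsto_ae atTop
      (f := fun (n : ℕ) x => slope (dLog f a b i x) θ (θ + (b - θ) / 2 / ((n : ℝ) + 1)))
      (fun n => ?_) ?_
    · simp only [slope_def_field]
      simp_rw [div_eq_mul_inv]
      exact ((ih (by omega) _ (hmem n)).sub (ih (by omega) _ hθ)).mul_const _
    · filter_upwards [h.regular] with x hx
      have hd := hx.hasDerivWithinAt_dLog h.lt (i := i) (by omega) (Ico_subset_Icc_self hθ)
      rw [hasDerivWithinAt_iff_tendsto_slope] at hd
      refine hd.comp (tendsto_nhdsWithin_iff.2 ⟨(tendsto_nhdsWithin_iff.1 hlim).1, ?_⟩)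
      filter_upwards [(tendsto_nhdsWithin_iff.1 hlim).2] with n hn
      exact ⟨Ico_subset_Icc_self (hmem n), ne_of_gt hn⟩

lemma memLp_dLog (h : RegularModel P f a b bd) {i : ℕ} (hi : i ≤ 3) {θ : ℝ} (hθ : θ ∈ Ioo a b) :
    MemLp (fun x => dLog f a b i x θ) 2 P := by
  refine (h.memLp_bound i hi).mono' (h.aestronglyMeasurable_dLog hi θ (Ioo_subset_Ico_self hθ)) ?_
  filter_upwards [h.regular] with x hx
  exact hx.bound i hi θ (Ioo_subset_Icc_self hθ)

lemma memLp_log (h : RegularModel P f a b bd) {θ : ℝ} (hθ : θ ∈ Icc a b) :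
    MemLp (fun x => dLog f a b 0 x θ) 2 P := by
  refine (h.memLp_bound 0 (by norm_num)).mono' ?_ ?_
  · simp_rw [dLog_zero]
    exact (h.measurable θ hθ).log.aestronglyMeasurable
  · filter_upwards [h.regular] with x hx
    exact hx.bound 0 (by norm_num) θ hθ

variable [IsProbabilityMeasure P]

/-- The score is centred and the mean Hessian is nonpositive at an interior maximizer of the
expected logarithmic density. -/
lemma integral_score_eq_zero_and_meanHessian_nonpos (h : RegularModel P f a b bd) {t : ℝ}
    (ht : t ∈ Ioo a b)
    (hmax : ∀ θ ∈ Icc a b, ∫ x, dLog f a b 0 x θ ∂P ≤ ∫ x, dLog f a b 0 x t ∂P) :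
    ∫ x, dLog f a b 1 x t ∂P = 0 ∧ meanHessian P f a b t ≤ 0 := by
  have htI := Ioo_subset_Icc_self ht
  obtain ⟨δ, hδ, hδs⟩ : ∃ δ > 0, Metric.closedBall t δ ⊆ Icc a b :=
    Metric.nhds_basis_closedBall.mem_iff.1 (Icc_mem_nhds ht.1 ht.2)
  have hmem : ∀ u, |u| ≤ δ → t + u ∈ Icc a b := fun u hu => hδs (by simpa using hu)
  have i0 : ∀ θ ∈ Icc a b, Integrable (fun x => dLog f a b 0 x θ) P := fun θ hθ =>
    (h.memLp_log hθ).integrable one_le_two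
  have i1 := (h.memLp_dLog (i := 1) (by norm_num) ht).integrable one_le_two
  have i2 := (h.memLp_dLog (i := 2) (by norm_num) ht).integrable one_le_two
  have i3 := (h.memLp_bound 3 le_rfl).integrable one_le_two
  refine eq_zero_and_nonpos_of_expansion_nonpos (R := ∫ x, bd 3 x ∂P) hδ
    (d := fun u => ∫ x, dLog f a b 0 x (t + u) ∂P - ∫ x, dLog f a b 0 x t ∂P)
    (fun u hu => sub_nonpos.2 (hmax _ (hmem u hu))) fun u hu => ?_
  have e : ∫ x, (dLog f a b 0 x (t + u) - dLog f a b 0 x t - u * dLog f a b 1 x t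
      - u ^ 2 / 2 * dLog f a b 2 x t) ∂P = ∫ x, dLog f a b 0 x (t + u) ∂P
      - ∫ x, dLog f a b 0 x t ∂P - u * ∫ x, dLog f a b 1 x t ∂P
      - u ^ 2 / 2 * meanHessian P f a b t := by
    have j0 : Integrable (fun x => dLog f a b 0 x (t + u) - dLog f a b 0 x t) P :=
      (i0 _ (hmem u hu)).sub (i0 t htI)
    have j1 : Integrable (fun x => dLog f a b 0 x (t + u) - dLog f a b 0 x t
      - u * dLog f a b 1 x t) P := j0.sub (i1.const_mul u)
    rw [integral_sub j1 (i2.const_mul _),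
      integral_sub j0 (i1.const_mul u), integral_sub (i0 _ (hmem u hu)) (i0 t htI),
      integral_const_mul, integral_const_mul, meanHessian]
  rw [← e, ← integral_mul_const]
  refine abs_integral_le_of_abs_le (i3.mul_const _) ?_
  filter_upwards [h.regular] with x hx
  simpa using hx.abs_dLog_zero_sub_le h.lt htI (hmem u hu)

variable {Ω : Type*} {X : ℕ → Ω → 𝒳}

/-- Uniform separation: if finitely many empirical means are close to their expectations, then the
empirical mean of the logarithmic density is smaller away from the maximizer of its expectation. -/
lemma exists_finset_separation (h : RegularModel P f a b bd) {t : ℝ} (ht : t ∈ Icc a b)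
    (hmax : ∀ θ ∈ Icc a b, θ ≠ t → ∫ x, dLog f a b 0 x θ ∂P < ∫ x, dLog f a b 0 x t ∂P)
    {δ : ℝ} (hδ : 0 < δ) :
    ∃ F : Set (𝒳 → ℝ), F.Finite ∧ (∀ g ∈ F, MemLp g 2 P) ∧ ∃ c > 0, ∀ (N : ℕ) (ω : Ω),
      (∀ n, RegularAt f a b bd (X n ω)) →
      (∀ g ∈ F, |empMean X N g ω - ∫ x, g x ∂P| < c) → ∀ θ ∈ Icc a b, δ ≤ |θ - t| →
      empMean X N (fun x => dLog f a b 0 x θ) ω < empMean X N (fun x => dLog f a b 0 x t) ω := by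
  set L : ℝ → ℝ := fun θ => ∫ x, dLog f a b 0 x θ ∂P with hL
  -- Bounds the Lipschitz constant of the empirical log-likelihood as soon as the empirical mean of
  -- `bd 1` is within `1` of its expectation.
  set M : ℝ := ∫ x, bd 1 x ∂P + 1
  have i0 : ∀ θ ∈ Icc a b, Integrable (fun x => dLog f a b 0 x θ) P := fun θ hθ =>
    (h.memLp_log hθ).integrable one_le_two
  have i1 := (h.memLp_bound 1 (by norm_num)).integrable one_le_two
  have hM1 : 0 ≤ ∫ x, bd 1 x ∂P := integral_nonneg_of_ae (by
    filter_upwards [h.regular] with x hx using hx.bound_nonneg h.lt (by norm_num))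
  have hM : 0 < M := by positivity
  have hLip : ∀ θ ∈ Icc a b, ∀ θ' ∈ Icc a b, |L θ - L θ'| ≤ (∫ x, bd 1 x ∂P) * |θ - θ'| := by
    intro θ hθ θ' hθ'
    simp only [hL]
    rw [← integral_sub (i0 θ hθ) (i0 θ' hθ'), ← integral_mul_const]
    refine abs_integral_le_of_abs_le (i1.mul_const _) ?_
    filter_upwards [h.regular] with x hx
    exact hx.abs_dLog_sub_le h.lt (by norm_num) hθ' hθ
  have hcont : ContinuousOn L (Icc a b) := by
    refine (LipschitzOnWith.of_dist_le_mul (K := ⟨_, hM1⟩) fun θ hθ θ' hθ' => ?_).continuousOn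
    exact hLip θ hθ θ' hθ'
  set K : Set ℝ := {θ ∈ Icc a b | δ ≤ |θ - t|}
  have hKc : IsCompact K := isCompact_Icc.inter_right
    (isClosed_le continuous_const (continuous_id.sub continuous_const).abs)
  have hKs : K ⊆ Icc a b := fun θ hθ => hθ.1
  -- Compactness gives a uniform gap `4κ`. Three `κ` are spent: the deviations at `t` and at a net
  -- point, and the step from `θ` to that net point, at distance below `κ / M`.
  obtain ⟨κ, hκ, hκK⟩ : ∃ κ > 0, ∀ θ ∈ K, L θ + 4 * κ ≤ L t := by
    rcases K.eq_empty_or_nonempty with hK | hK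
    · exact ⟨1, one_pos, by simp [hK]⟩
    · obtain ⟨θ₀, hθ₀, hm⟩ := hKc.exists_isMaxOn hK (hcont.mono hKs)
      have hne : θ₀ ≠ t := by
        rintro rfl
        have := hθ₀.2
        simp only [sub_self, abs_zero] at this
        linarith
      have hlt := hmax θ₀ (hKs hθ₀) hne
      refine ⟨(L t - L θ₀) / 4, by simp only [hL]; linarith, fun θ hθ => ?_⟩
      have : L θ ≤ L θ₀ := hm hθ
      linarith
  obtain ⟨s, hsK, hsf, hs⟩ := hKc.finite_cover_balls (div_pos hκ hM)
  refine ⟨insert (bd 1) (insert (fun x => dLog f a b 0 x t)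
    ((fun θ x => dLog f a b 0 x θ) '' s)), ((hsf.image _).insert _).insert _, ?_,
    min κ 1, lt_min hκ one_pos, fun N ω hω hF θ hθ hθδ => ?_⟩
  · rintro g (rfl | rfl | ⟨θ, hθ, rfl⟩)
    · exact h.memLp_bound 1 (by norm_num)
    · exact h.memLp_log ht
    · exact h.memLp_log (hKs (hsK hθ))
  · obtain ⟨θ', hθ's, hθ'⟩ := mem_iUnion₂.1 (hs (show θ ∈ K from ⟨hθ, hθδ⟩))
    have hθ'K := hsK hθ's
    have d1 := hF (bd 1) (by simp)
    have d2 := hF (fun x => dLog f a b 0 x t) (by simp)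
    have d3 := hF (fun x => dLog f a b 0 x θ') (by
      right; right; exact ⟨θ', hθ's, rfl⟩)
    have d1' := (abs_lt.1 (d1.trans_le (min_le_right _ _))).2
    have d2' := (abs_lt.1 (d2.trans_le (min_le_left _ _))).1
    have d3' := (abs_lt.1 (d3.trans_le (min_le_left _ _))).2
    have hdist : |θ - θ'| < κ / M := by simpa [Real.dist_eq] using hθ'
    have hb0 : 0 ≤ empMean X N (bd 1) ω := by
      have := empMean_mono (X := X) (N := N) (g := fun _ => 0) (h := bd 1) (ω := ω)
        fun n => (hω n).bound_nonneg h.lt (by norm_num)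
      simpa [empMean] using this
    have hle : |empMean X N (fun x => dLog f a b 0 x θ) ω -
        empMean X N (fun x => dLog f a b 0 x θ') ω| ≤ |θ - θ'| * empMean X N (bd 1) ω := by
      rw [← empMean_sub, ← empMean_const_mul]
      refine abs_empMean_le fun n => ?_
      rw [mul_comm]
      exact (hω n).abs_dLog_sub_le h.lt (by norm_num) (hKs hθ'K) hθ
    have hprod : |θ - θ'| * empMean X N (bd 1) ω ≤ κ := by
      calc |θ - θ'| * empMean X N (bd 1) ω ≤ κ / M * M := by
            gcongr
            simp only [M]
            linarith
        _ = κ := div_mul_cancel₀ _ hM.ne'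
    have := (abs_le.1 hle).2
    have := hκK θ' hθ'K
    simp only [hL] at this
    linarith

end RegularModel

end Model

/-! ### Simultaneous control of finitely many empirical means. -/

section FiniteFamilies

variable {Ω 𝒳 : Type*} [MeasurableSpace Ω] [MeasurableSpace 𝒳]
  {X : ℕ → Ω → 𝒳} {P : Measure 𝒳} {μ : Measure Ω} [IsProbabilityMeasure μ]
  [IsProbabilityMeasure P]

lemma IsIIDSample.tendsto_mul_measureReal_finite (h : IsIIDSample X P μ) {F : Set (𝒳 → ℝ)}
    (hF : F.Finite) (hL : ∀ g ∈ F, MemLp g 2 P) {c : ℝ} (hc : 0 < c) :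
    Tendsto (fun N : ℕ => N * μ.real {ω | ¬ ∀ g ∈ F, |empMean X N g ω - ∫ x, g x ∂P| < c})
      atTop (𝓝 0) := by
  have hsum : Tendsto (fun N : ℕ => ∑ g ∈ hF.toFinset,
      N * μ.real {ω | c ≤ |empMean X N g ω - ∫ x, g x ∂P|}) atTop (𝓝 (∑ g ∈ hF.toFinset, 0)) :=
    tendsto_finsetSum _ fun g hg =>
      h.tendsto_mul_measureReal_deviation (hL g (hF.mem_toFinset.1 hg)) hc
  rw [Finset.sum_const_zero] at hsum
  refine squeeze_zero (fun N => by positivity) (fun N => ?_) hsum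
  rw [← Finset.mul_sum]
  gcongr
  refine le_trans (measureReal_mono ?_ (measure_ne_top _ _)) (measureReal_biUnion_finset_le _ _)
  intro ω hω
  simp only [mem_ofPred_eq, not_forall, not_lt] at hω
  obtain ⟨g, hg, hgc⟩ := hω
  exact mem_iUnion₂.2 ⟨g, hF.mem_toFinset.2 hg, hgc⟩

lemma IsIIDSample.ae_eventually_finite (h : IsIIDSample X P μ) {F : Set (𝒳 → ℝ)}
    (hF : F.Finite) (hL : ∀ g ∈ F, MemLp g 2 P) {c : ℝ} (hc : 0 < c) :
    ∀ᵐ ω ∂μ, ∀ᶠ N in atTop, ∀ g ∈ F, |empMean X N g ω - ∫ x, g x ∂P| < c := by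
  have : ∀ᵐ ω ∂μ, ∀ g ∈ F, Tendsto (fun N => empMean X N g ω) atTop (𝓝 (∫ x, g x ∂P)) :=
    (ae_ball_iff hF.countable).2 fun g hg => h.ae_tendsto_empMean ((hL g hg).integrable one_le_two)
  filter_upwards [this] with ω hω
  exact (eventually_all_finite hF).2 fun g hg =>
    (hω g hg).eventually (Metric.ball_mem_nhds _ hc)

end FiniteFamilies

end MML

namespace MML

/-! ### The likelihood expressed through empirical means. -/

section Likelihood

variable {Ω 𝒳 : Type*} {f : 𝒳 → ℝ → ℝ} {a b : ℝ} {bd : ℕ → 𝒳 → ℝ} {X : ℕ → Ω → 𝒳} {ω : Ω}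

lemma likelihood_pos (hω : ∀ n, RegularAt f a b bd (X n ω)) (N : ℕ) {θ : ℝ} (hθ : θ ∈ Icc a b) :
    0 < likelihood f (sample X N ω) θ :=
  Finset.prod_pos fun n _ => (hω n).pos θ hθ

lemma log_likelihood (hω : ∀ n, RegularAt f a b bd (X n ω)) (N : ℕ) {θ : ℝ} (hθ : θ ∈ Icc a b) :
    Real.log (likelihood f (sample X N ω) θ) =
      ∑ n ∈ Finset.range N, dLog f a b 0 (X n ω) θ := by
  simp only [likelihood, sample, dLog_zero]
  rw [Real.log_prod (f := fun n : Fin N => f (X n ω) θ) fun n _ => ((hω n).pos θ hθ).ne']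
  exact Fin.sum_univ_eq_sum_range (fun n => Real.log (f (X n ω) θ)) N

lemma likelihood_le_iff_sum (hω : ∀ n, RegularAt f a b bd (X n ω)) (N : ℕ) {θ θ' : ℝ}
    (hθ : θ ∈ Icc a b) (hθ' : θ' ∈ Icc a b) :
    likelihood f (sample X N ω) θ ≤ likelihood f (sample X N ω) θ' ↔
      ∑ n ∈ Finset.range N, dLog f a b 0 (X n ω) θ ≤
        ∑ n ∈ Finset.range N, dLog f a b 0 (X n ω) θ' := by
  rw [← log_likelihood hω N hθ, ← log_likelihood hω N hθ',
    Real.log_le_log_iff (likelihood_pos hω N hθ) (likelihood_pos hω N hθ')]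

lemma likelihood_le_iff_empMean (hω : ∀ n, RegularAt f a b bd (X n ω)) {N : ℕ} (hN : N ≠ 0)
    {θ θ' : ℝ} (hθ : θ ∈ Icc a b) (hθ' : θ' ∈ Icc a b) :
    likelihood f (sample X N ω) θ ≤ likelihood f (sample X N ω) θ' ↔
      empMean X N (fun x => dLog f a b 0 x θ) ω ≤ empMean X N (fun x => dLog f a b 0 x θ') ω := by
  rw [likelihood_le_iff_sum hω N hθ hθ', empMean, empMean, div_le_div_iff_of_pos_right]
  positivity

/-- The score of the sample vanishes at an interior maximizer of the likelihood. -/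
lemma empMean_score_eq_zero (hab : a < b) (hω : ∀ n, RegularAt f a b bd (X n ω)) {N : ℕ}
    (hN : N ≠ 0) {θ : ℝ} (hθ : θ ∈ Ioo a b)
    (hmax : IsMaxOn (likelihood f (sample X N ω)) (Icc a b) θ) :
    empMean X N (fun x => dLog f a b 1 x θ) ω = 0 := by
  have hnhds : Icc a b ∈ 𝓝 θ := Icc_mem_nhds hθ.1 hθ.2
  have hd : HasDerivAt (fun y => empMean X N (fun x => dLog f a b 0 x y) ω)
      (empMean X N (fun x => dLog f a b 1 x θ) ω) θ :=
    (HasDerivAt.fun_sum fun n _ => ((hω n).hasDerivWithinAt_dLog hab (i := 0) (by norm_num)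
      (Ioo_subset_Icc_self hθ)).hasDerivAt hnhds).div_const _
  refine IsLocalMax.hasDerivAt_eq_zero ?_ hd
  filter_upwards [hnhds] with y hy
  exact (likelihood_le_iff_empMean hω hN hy (Ioo_subset_Icc_self hθ)).1 (hmax hy)

end Likelihood

/-! ### Local quadratic behaviour, consistency and asymptotic variance. -/

section Asymptotics

variable {Ω 𝒳 : Type*} [MeasurableSpace Ω] [MeasurableSpace 𝒳]
  {X : ℕ → Ω → 𝒳} {P : Measure 𝒳} {μ : Measure Ω} [IsProbabilityMeasure μ]
  [IsProbabilityMeasure P] {f : 𝒳 → ℝ → ℝ} {a b : ℝ} {bd : ℕ → 𝒳 → ℝ} {t : ℝ}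

/-- The local behaviour of the empirical logarithmic likelihood around `t`: it is smaller than at
`t` outside the `δ`-ball, and close to a parabola inside. -/
structure LocallyQuadratic (X : ℕ → Ω → 𝒳) (f : 𝒳 → ℝ → ℝ) (a b t α η δ : ℝ) (N : ℕ) (ω : Ω) :
    Prop where
  far : ∀ θ ∈ Icc a b, δ ≤ |θ - t| →
    empMean X N (fun x => dLog f a b 0 x θ) ω < empMean X N (fun x => dLog f a b 0 x t) ω
  near : ∀ u, |u| ≤ δ → |empMean X N (fun x => dLog f a b 0 x (t + u)) ω -
    empMean X N (fun x => dLog f a b 0 x t) ω - u * empMean X N (fun x => dLog f a b 1 x t) ω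
      + α * u ^ 2 / 2| ≤ η * u ^ 2 / 2
  score : ∀ u, |u| ≤ δ → |empMean X N (fun x => dLog f a b 1 x (t + u)) ω -
    empMean X N (fun x => dLog f a b 1 x t) ω + α * u| ≤ η * |u|
  small : 2 * |empMean X N (fun x => dLog f a b 1 x t) ω| ≤ α * δ

lemma RegularModel.exists_locallyQuadratic (h : RegularModel P f a b bd) (hI : IsIIDSample X P μ)
    (ht : t ∈ Ioo a b)
    (hmax : ∀ θ ∈ Icc a b, θ ≠ t → ∫ x, dLog f a b 0 x θ ∂P < ∫ x, dLog f a b 0 x t ∂P)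
    (hscore : ∫ x, dLog f a b 1 x t ∂P = 0) (hA : meanHessian P f a b t < 0) {η : ℝ}
    (hη : 0 < η) :
    ∃ δ > 0, Metric.closedBall t δ ⊆ Icc a b ∧ ∃ E : ℕ → Set Ω,
      Tendsto (fun N : ℕ => N * μ.real (E N)) atTop (𝓝 0) ∧
      ∀ᶠ N in atTop, ∀ ω, (∀ n, RegularAt f a b bd (X n ω)) → ω ∉ E N →
        LocallyQuadratic X f a b t (-meanHessian P f a b t) η δ N ω := by
  have htI := Ioo_subset_Icc_self ht
  obtain ⟨δ₀, hδ₀, hδ₀s⟩ : ∃ δ > 0, Metric.closedBall t δ ⊆ Icc a b :=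
    Metric.nhds_basis_closedBall.mem_iff.1 (Icc_mem_nhds ht.1 ht.2)
  set α := -meanHessian P f a b t with hα
  have hα0 : 0 < α := neg_pos.2 hA
  set R₀ : ℝ := ∫ x, bd 3 x ∂P + 1
  have hR₀ : 0 < R₀ := by
    have : 0 ≤ ∫ x, bd 3 x ∂P := integral_nonneg_of_ae (by
      filter_upwards [h.regular] with x hx using hx.bound_nonneg h.lt le_rfl)
    positivity
  -- Makes the cubic remainder at most `η u² / 4`. A Hessian error of `η / 2` adds another `η u² /
  -- 4`, which exhausts the allowed `η u² / 2`.
  set δ := min δ₀ (η / (4 * R₀))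
  have hδ : 0 < δ := lt_min hδ₀ (by positivity)
  have hδs : Metric.closedBall t δ ⊆ Icc a b :=
    (Metric.closedBall_subset_closedBall (min_le_left _ _)).trans hδ₀s
  have hRδ : R₀ * δ ≤ η / 4 := by
    have : δ ≤ η / (4 * R₀) := min_le_right _ _
    rw [le_div_iff₀ (by positivity)] at this
    linarith
  obtain ⟨F, hF, hFL, c, hc, hsep⟩ := h.exists_finset_separation (X := X) htI hmax hδ
  set F' : Set (𝒳 → ℝ) := insert (bd 3) (insert (fun x => dLog f a b 1 x t)
    (insert (fun x => dLog f a b 2 x t) F))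
  -- The four tolerances serve, in order, the separation, the bound `R₀` for the mean of `bd 3`, the
  -- Hessian and the smallness of the score.
  set c' := min (min c 1) (min (η / 2) (α * δ / 2))
  have hc' : 0 < c' := by positivity
  have hF'L : ∀ g ∈ F', MemLp g 2 P := by
    rintro g (rfl | rfl | rfl | hg)
    · exact h.memLp_bound 3 le_rfl
    · exact h.memLp_dLog (by norm_num) ht
    · exact h.memLp_dLog (by norm_num) ht
    · exact hFL g hg
  refine ⟨δ, hδ, hδs, fun N => {ω | ¬ ∀ g ∈ F', |empMean X N g ω - ∫ x, g x ∂P| < c'},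
    hI.tendsto_mul_measureReal_finite (((hF.insert _).insert _).insert _) hF'L hc',
    .of_forall fun N ω hω hωE => ?_⟩
  replace hωE : ∀ g ∈ F', |empMean X N g ω - ∫ x, g x ∂P| < c' := by simpa using hωE
  have hmem : ∀ u, |u| ≤ δ → t + u ∈ Icc a b := fun u hu => hδs (by simpa using hu)
  have hR : empMean X N (bd 3) ω ≤ R₀ := by
    have h1 := hωE (bd 3) (by simp [F'])
    have h2 := (abs_lt.1 (h1.trans_le ((min_le_left _ _).trans (min_le_right _ _)))).2
    simp only [R₀]
    linarith
  have hH : |empMean X N (fun x => dLog f a b 2 x t) ω + α| ≤ η / 2 := by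
    have h1 := hωE (fun x => dLog f a b 2 x t) (by simp [F'])
    have h2 := (h1.trans_le ((min_le_right _ _).trans (min_le_left _ _))).le
    rwa [hα, ← sub_eq_add_neg]
  have hS : |empMean X N (fun x => dLog f a b 1 x t) ω| ≤ α * δ / 2 := by
    have h1 := hωE (fun x => dLog f a b 1 x t) (by simp [F'])
    have h2 := (h1.trans_le ((min_le_right _ _).trans (min_le_right _ _))).le
    rwa [hscore, sub_zero] at h2
  have hRu : ∀ u, |u| ≤ δ → empMean X N (bd 3) ω * |u| ≤ η / 4 := fun u hu =>
    (mul_le_mul hR hu (abs_nonneg _) hR₀.le).trans hRδ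
  refine ⟨hsep N ω hω fun g hg => (hωE g (by simp [F', hg])).trans_le
    ((min_le_left _ _).trans (min_le_left _ _)), fun u hu => ?_, fun u hu => ?_, by linarith⟩
  · have h1 : |empMean X N (fun x => dLog f a b 0 x (t + u)) ω -
        empMean X N (fun x => dLog f a b 0 x t) ω -
        u * empMean X N (fun x => dLog f a b 1 x t) ω -
        u ^ 2 / 2 * empMean X N (fun x => dLog f a b 2 x t) ω| ≤
        |u| ^ 3 * empMean X N (bd 3) ω := by
      simp only [← empMean_const_mul, ← empMean_sub]
      refine abs_empMean_le fun n => ?_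
      rw [mul_comm (|u| ^ 3)]
      simpa using (hω n).abs_dLog_zero_sub_le h.lt htI (hmem u hu)
    have h2 := hRu u hu
    have h3 : |u| ^ 3 * empMean X N (bd 3) ω ≤ η / 4 * u ^ 2 := by
      calc |u| ^ 3 * empMean X N (bd 3) ω = empMean X N (bd 3) ω * |u| * |u| ^ 2 := by ring
        _ ≤ η / 4 * |u| ^ 2 := by gcongr
        _ = η / 4 * u ^ 2 := by rw [sq_abs]
    rw [abs_le] at h1 hH ⊢
    have h4 := sq_nonneg u
    constructor <;> nlinarith
  · have h1 : |empMean X N (fun x => dLog f a b 1 x (t + u)) ω -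
        empMean X N (fun x => dLog f a b 1 x t) ω -
        u * empMean X N (fun x => dLog f a b 2 x t) ω| ≤ |u| ^ 2 * empMean X N (bd 3) ω := by
      simp only [← empMean_const_mul, ← empMean_sub]
      refine abs_empMean_le fun n => ?_
      rw [mul_comm (|u| ^ 2)]
      simpa using (hω n).abs_dLog_one_sub_le h.lt htI (hmem u hu)
    have h2 : |u| ^ 2 * empMean X N (bd 3) ω ≤ η / 4 * |u| := by
      calc |u| ^ 2 * empMean X N (bd 3) ω = empMean X N (bd 3) ω * |u| * |u| := by ring
        _ ≤ η / 4 * |u| := by gcongr; exact hRu u hu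
    have h3 : |u * (empMean X N (fun x => dLog f a b 2 x t) ω + α)| ≤ η / 2 * |u| := by
      rw [abs_mul, mul_comm]
      gcongr
    have h4 := abs_nonneg u
    calc _ = |(empMean X N (fun x => dLog f a b 1 x (t + u)) ω -
        empMean X N (fun x => dLog f a b 1 x t) ω -
        u * empMean X N (fun x => dLog f a b 2 x t) ω) +
          u * (empMean X N (fun x => dLog f a b 2 x t) ω + α)| := by ring_nf
      _ ≤ _ := abs_add_le _ _
      _ ≤ η * |u| := by nlinarith

/-- A bounded statistic which outside the exceptional events is close to `(S / α)²`, where `S` is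
the empirical score, has asymptotic mean equal to the misspecified Cramer-Rao bound. -/
lemma RegularModel.tendsto_mul_integral (h : RegularModel P f a b bd) (hI : IsIIDSample X P μ)
    (ht : t ∈ Ioo a b)
    (hmax : ∀ θ ∈ Icc a b, θ ≠ t → ∫ x, dLog f a b 0 x θ ∂P < ∫ x, dLog f a b 0 x t ∂P)
    (hA : meanHessian P f a b t ≠ 0) {Y : ℕ → Ω → ℝ} {D : ℝ}
    (hYi : ∀ N, Integrable (Y N) μ) (hY0 : ∀ N, ∀ᵐ ω ∂μ, 0 ≤ Y N ω)
    (hYD : ∀ N, ∀ᵐ ω ∂μ, Y N ω ≤ D)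
    (hY : ∀ α η δ : ℝ, 0 < η → η < α → 0 < δ → Metric.closedBall t δ ⊆ Icc a b →
      ∀ N : ℕ, N ≠ 0 → ∀ᵐ ω ∂μ, LocallyQuadratic X f a b t α η δ N ω →
        empMean X N (fun x => dLog f a b 1 x t) ω ^ 2 / (α + η) ^ 2 ≤ Y N ω ∧
        Y N ω ≤ empMean X N (fun x => dLog f a b 1 x t) ω ^ 2 / (α - η) ^ 2) :
    Tendsto (fun N : ℕ => N * ∫ ω, Y N ω ∂μ) atTop (𝓝 (mcrlb P f a b t)) := by
  have htI := Ioo_subset_Icc_self ht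
  obtain ⟨hscore, hA'⟩ := h.integral_score_eq_zero_and_meanHessian_nonpos ht fun θ hθ => by
    rcases eq_or_ne θ t with rfl | hne
    · exact le_rfl
    · exact (hmax θ hθ hne).le
  have hneg : meanHessian P f a b t < 0 := lt_of_le_of_ne hA' hA
  have hL : MemLp (fun x => dLog f a b 1 x t) 2 P := h.memLp_dLog (by norm_num) ht
  rw [mcrlb, ← neg_sq (meanHessian P f a b t)]
  refine tendsto_mul_integral_of_sandwich (S := fun N => empMean X N fun x => dLog f a b 1 x t)
    (neg_pos.2 hneg) (fun N => (hI.memLp_empMean hL N).integrable_sq) ?_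
    (fun E hE => hI.tendsto_mul_setIntegral_sq_empMean hL hscore hE) hYi hY0 hYD ?_
  · filter_upwards [eventually_ne_atTop 0] with N hN
    exact hI.mul_integral_sq_empMean hL hscore hN
  · intro η hη hηa
    obtain ⟨δ, hδ, hδs, E, hE, hEN⟩ := h.exists_locallyQuadratic hI ht hmax hscore hneg hη
    refine ⟨E, hE, ?_⟩
    filter_upwards [hEN, eventually_ne_atTop 0] with N hN hN0
    filter_upwards [hI.ae_forall h.regular, hY _ η δ hη hηa hδ hδs N hN0] with ω h1 h2 h3
    exact h2 (hN ω h1 h3)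

variable {θhat : (N : ℕ) → (Fin N → 𝒳) → ℝ}

/-- Almost sure consistency of the misspecified maximum likelihood estimator. -/
lemma RegularModel.ae_tendsto_estimator (h : RegularModel P f a b bd) (hI : IsIIDSample X P μ)
    (ht : t ∈ Ioo a b)
    (hmax : ∀ θ ∈ Icc a b, θ ≠ t → ∫ x, dLog f a b 0 x θ ∂P < ∫ x, dLog f a b 0 x t ∂P)
    (hθhat : ∀ N, ∀ᵐ ω ∂μ, θhat N (sample X N ω) ∈ Icc a b ∧
      IsMaxOn (likelihood f (sample X N ω)) (Icc a b) (θhat N (sample X N ω))) :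
    ∀ᵐ ω ∂μ, Tendsto (fun N => θhat N (sample X N ω)) atTop (𝓝 t) := by
  have htI := Ioo_subset_Icc_self ht
  -- The exceptional null set depends on the radius, so only the countably many radii `1 / (k + 1)`
  -- are used.
  have key : ∀ k : ℕ, ∀ᵐ ω ∂μ, ∀ᶠ N in atTop,
      |θhat N (sample X N ω) - t| < 1 / ((k : ℝ) + 1) := fun k => by
    obtain ⟨F, hF, hFL, c, hc, hsep⟩ := h.exists_finset_separation (X := X) htI hmax
      (δ := 1 / ((k : ℝ) + 1)) (by positivity)
    filter_upwards [hI.ae_forall h.regular, hI.ae_eventually_finite hF hFL hc,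
      ae_all_iff.2 hθhat] with ω hω hev hhat
    filter_upwards [hev, eventually_ne_atTop 0] with N hN hN0
    by_contra! hge
    exact (hsep N ω hω hN _ (hhat N).1 hge).not_ge
      ((likelihood_le_iff_empMean hω hN0 htI (hhat N).1).1 ((hhat N).2 htI))
  filter_upwards [ae_all_iff.2 key] with ω hω
  rw [Metric.tendsto_nhds]
  intro ε hε
  obtain ⟨k, hk⟩ := exists_nat_one_div_lt hε
  filter_upwards [hω k] with N hN
  exact hN.trans hk

/-- The asymptotic variance of the misspecified maximum likelihood estimator. -/
lemma RegularModel.hasAsymptoticVariance (h : RegularModel P f a b bd) (hI : IsIIDSample X P μ)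
    (ht : t ∈ Ioo a b)
    (hmax : ∀ θ ∈ Icc a b, θ ≠ t → ∫ x, dLog f a b 0 x θ ∂P < ∫ x, dLog f a b 0 x t ∂P)
    (hA : meanHessian P f a b t ≠ 0) (hθmeas : ∀ N, Measurable (θhat N))
    (hθhat : ∀ N, ∀ᵐ ω ∂μ, θhat N (sample X N ω) ∈ Icc a b ∧
      IsMaxOn (likelihood f (sample X N ω)) (Icc a b) (θhat N (sample X N ω))) :
    HasAsymptoticVariance μ X θhat t (mcrlb P f a b t) := by
  have hm : ∀ N, Measurable fun ω => (θhat N (sample X N ω) - t) ^ 2 := fun N =>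
    (((hθmeas N).comp (measurable_pi_lambda _ fun n => hI.measurable n)).sub_const t).pow_const 2
  have hD : ∀ N, ∀ᵐ ω ∂μ, (θhat N (sample X N ω) - t) ^ 2 ≤ (b - a) ^ 2 := fun N => by
    filter_upwards [hθhat N] with ω hω
    have := hω.1.1
    have := hω.1.2
    have := ht.1
    have := ht.2
    exact sq_le_sq' (by linarith) (by linarith)
  refine h.tendsto_mul_integral hI ht hmax hA (D := (b - a) ^ 2) (fun N => ?_)
    (fun N => .of_forall fun ω => sq_nonneg _) hD ?_
  · refine (integrable_const ((b - a) ^ 2)).mono' (hm N).aestronglyMeasurable ?_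
    filter_upwards [hD N] with ω hω
    rwa [Real.norm_of_nonneg (sq_nonneg _)]
  · intro α η δ hη hηα hδ hδs N hN
    filter_upwards [hI.ae_forall h.regular, hθhat N] with ω hω hhat hq
    have htI := Ioo_subset_Icc_self ht
    set θ := θhat N (sample X N ω)
    -- A maximizer cannot lie where the likelihood is below its value at `t`. It is thus interior,
    -- and the score equation with the expansion of the score gives `|S - α (θ - t)| ≤ η |θ - t|`.
    have hlt : |θ - t| < δ := by
      by_contra! hge
      exact (hq.far θ hhat.1 hge).not_ge
        ((likelihood_le_iff_empMean hω hN htI hhat.1).1 (hhat.2 htI))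
    have hθ : θ ∈ Ioo a b := by
      rw [← interior_Icc]
      exact interior_maximal (Metric.ball_subset_closedBall.trans hδs) Metric.isOpen_ball hlt
    have h0 := empMean_score_eq_zero h.lt hω hN hθ hhat.2
    have h1 := hq.score (θ - t) hlt.le
    rw [add_sub_cancel, h0] at h1
    refine sq_bounds_of_abs_sub_le hη hηα ?_
    rw [abs_sub_comm]
    convert h1 using 2
    ring

end Asymptotics

end MML

namespace MML

/-! ### The predicted statistic as the expectation of a pathwise integral. -/

section Predicted

variable {Ω 𝒳 : Type*} [MeasurableSpace Ω] {X : ℕ → Ω → 𝒳} {μ : Measure Ω}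
  {f : 𝒳 → ℝ → ℝ} {a b t : ℝ} {T : Set (ℝ × Ω)} {N : ℕ}

/-- `T` plays the role of a jointly measurable version of the likelihood comparison, as Fubini
requires; one null set of `ω` serves all `ε`. -/
lemma predictedIntegrand_eq (hTae : ∀ᵐ ω ∂μ, ∀ ε ∈ Icc ((a - t) / 2) ((b - t) / 2),
      ((ε, ω) ∈ T ↔ likelihood f (sample X N ω) (t + 2 * ε) ≥ likelihood f (sample X N ω) t))
    {ε : ℝ} (hε : ε ∈ Icc ((a - t) / 2) ((b - t) / 2)) :
    predictedIntegrand μ X f t N ε = |ε| * μ.real (Prod.mk ε ⁻¹' T) := by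
  rw [predictedIntegrand]
  congr 1
  refine measureReal_congr ?_
  filter_upwards [hTae] with ω hω
  exact propext (hω ε hε).symm

variable [IsProbabilityMeasure μ]

lemma integrableOn_predictedIntegrand (hT : MeasurableSet T)
    (hTae : ∀ᵐ ω ∂μ, ∀ ε ∈ Icc ((a - t) / 2) ((b - t) / 2),
      ((ε, ω) ∈ T ↔ likelihood f (sample X N ω) (t + 2 * ε) ≥ likelihood f (sample X N ω) t)) :
    IntegrableOn (predictedIntegrand μ X f t N) (Icc ((a - t) / 2) ((b - t) / 2)) := by
  refine (integrableOn_congr_fun (fun ε hε => predictedIntegrand_eq hTae hε)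
    measurableSet_Icc).2 ?_
  refine Integrable.mono' continuous_abs.integrableOn_Icc
    (measurable_id.abs.mul (measurable_measure_prodMk_left hT).ennreal_toReal).aestronglyMeasurable
    (.of_forall fun ε => ?_)
  rw [norm_mul, Real.norm_eq_abs, abs_abs, Real.norm_of_nonneg measureReal_nonneg]
  exact mul_le_of_le_one_right (abs_nonneg ε) measureReal_le_one

lemma integrable_prod_indicator_abs (hT : MeasurableSet T) (c d : ℝ) :
    Integrable (T.indicator fun p : ℝ × Ω => |p.1|) ((volume.restrict (Icc c d)).prod μ) :=
  (Integrable.comp_fst (f := fun ε : ℝ => |ε|)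
    (show Integrable _ (volume.restrict (Icc c d)) from
      continuous_abs.integrableOn_Icc) μ).indicator hT

lemma integral_section_indicator_abs (hT : MeasurableSet T) (c d : ℝ) (ω : Ω) :
    ∫ ε in Icc c d, T.indicator (fun p : ℝ × Ω => |p.1|) (ε, ω) =
      ∫ ε in Icc c d ∩ {ε | (ε, ω) ∈ T}, |ε| := by
  have hm : MeasurableSet {ε | (ε, ω) ∈ T} := measurable_prodMk_right hT
  rw [← setIntegral_indicator hm]
  rfl

lemma integrable_section_abs (hT : MeasurableSet T) (c d : ℝ) :
    Integrable (fun ω => ∫ ε in Icc c d ∩ {ε | (ε, ω) ∈ T}, |ε|) μ := by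
  simpa only [integral_section_indicator_abs hT] using
    (integrable_prod_indicator_abs (μ := μ) hT c d).integral_prod_right

/-- The predicted statistic is the mean of a pathwise integral over the set of parameters whose
likelihood exceeds that of `t`. -/
lemma predictedStatistic_eq (hab : a ≤ b) (hT : MeasurableSet T)
    (hTae : ∀ᵐ ω ∂μ, ∀ ε ∈ Icc ((a - t) / 2) ((b - t) / 2),
      ((ε, ω) ∈ T ↔ likelihood f (sample X N ω) (t + 2 * ε) ≥ likelihood f (sample X N ω) t)) :
    predictedStatistic μ X f a b t N =
      ∫ ω, (2 * ∫ ε in Icc ((a - t) / 2) ((b - t) / 2) ∩ {ε | (ε, ω) ∈ T}, |ε|) ∂μ := by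
  rw [predictedStatistic, integral_const_mul, intervalIntegral.integral_of_le (by linarith),
    ← integral_Icc_eq_integral_Ioc]
  congr 1
  simp_rw [← integral_section_indicator_abs hT]
  rw [← integral_integral_swap (f := fun (ε : ℝ) ω => T.indicator (fun p : ℝ × Ω => |p.1|) (ε, ω))
    (integrable_prod_indicator_abs hT _ _)]
  refine setIntegral_congr_fun measurableSet_Icc fun ε hε => ?_
  have hm : MeasurableSet (Prod.mk ε ⁻¹' T) := measurable_prodMk_left hT
  change _ = ∫ ω, (Prod.mk ε ⁻¹' T).indicator (fun _ => |ε|) ω ∂μ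
  rw [predictedIntegrand_eq hTae hε, integral_indicator hm, setIntegral_const, smul_eq_mul,
    mul_comm]

end Predicted

/-! ### Joint measurability and the limit of the predicted statistic. -/

section PredictedAsymptotics

variable {Ω 𝒳 : Type*} [MeasurableSpace Ω] [MeasurableSpace 𝒳] {X : ℕ → Ω → 𝒳}
  {P : Measure 𝒳} {μ : Measure Ω} {f : 𝒳 → ℝ → ℝ} {a b t : ℝ} {bd : ℕ → 𝒳 → ℝ}

/-- A jointly measurable version of the logarithmic density. -/
lemma RegularModel.exists_measurable_uncurry_log (h : RegularModel P f a b bd) :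
    ∃ g : ℝ → 𝒳 → ℝ, Measurable (Function.uncurry g) ∧
      ∀ᵐ x ∂P, ∀ θ ∈ Icc a b, g θ x = dLog f a b 0 x θ := by
  set G : Set 𝒳 := (toMeasurable P {x | ¬ RegularAt f a b bd x})ᶜ
  have hG : MeasurableSet G := (measurableSet_toMeasurable _ _).compl
  have hGr : ∀ x ∈ G, RegularAt f a b bd x := fun x hx => by
    by_contra hn
    exact hx (subset_toMeasurable _ _ hn)
  -- Projecting `θ` to `[a, b]` and cutting off outside the measurable full-measure set `G` yields a
  -- function continuous in `θ` and measurable in `x` everywhere, hence jointly measurable.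
  refine ⟨fun θ => G.indicator fun x => Real.log (f x (projIcc a b h.lt.le θ)),
    measurable_uncurry_of_continuous_of_measurable (fun x => ?_) (fun θ => ?_), ?_⟩
  · by_cases hx : x ∈ G
    · simp only [indicator_of_mem hx]
      exact (continuousOn_iff_continuous_domRestrict.1 (hGr x hx).continuousOn).comp
        continuous_projIcc
    · simp only [indicator_of_notMem hx]
      exact continuous_const
  · exact (h.measurable _ (projIcc a b h.lt.le θ).2).log.indicator hG
  · have : ∀ᵐ x ∂P, x ∈ G := by
      rw [ae_iff]
      simpa [G, measure_toMeasurable] using ae_iff.1 h.regular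
    filter_upwards [this] with x hx θ hθ
    simp only [indicator_of_mem hx, dLog_zero, projIcc_of_mem h.lt.le hθ]

/-- The comparison is made between sums of the jointly measurable log-densities; using sums instead
of means includes `N = 0`. -/
lemma IsIIDSample.exists_measurableSet_likelihood_ge (hI : IsIIDSample X P μ)
    (h : RegularModel P f a b bd) (ht : t ∈ Icc a b) (N : ℕ) :
    ∃ T : Set (ℝ × Ω), MeasurableSet T ∧ ∀ᵐ ω ∂μ, ∀ ε ∈ Icc ((a - t) / 2) ((b - t) / 2),
      ((ε, ω) ∈ T ↔ likelihood f (sample X N ω) (t + 2 * ε) ≥ likelihood f (sample X N ω) t) := by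
  obtain ⟨g, hg, hge⟩ := h.exists_measurable_uncurry_log
  have hm : ∀ {u : ℝ × Ω → ℝ}, Measurable u →
      Measurable fun p : ℝ × Ω => ∑ n ∈ Finset.range N, g (u p) (X n p.2) := fun hu =>
    Finset.measurable_fun_sum _ fun n _ =>
      hg.comp (hu.prodMk ((hI.measurable n).comp measurable_snd))
  refine ⟨{p | ∑ n ∈ Finset.range N, g t (X n p.2) ≤
    ∑ n ∈ Finset.range N, g (t + 2 * p.1) (X n p.2)},
    measurableSet_le (hm measurable_const) (hm (by fun_prop)), ?_⟩
  filter_upwards [hI.ae_forall h.regular, hI.ae_forall hge] with ω hω hgω ε hε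
  have hε' : t + 2 * ε ∈ Icc a b := ⟨by linarith [hε.1], by linarith [hε.2]⟩
  rw [ge_iff_le, likelihood_le_iff_sum hω N ht hε']
  simp only [hgω _ _ ht, hgω _ _ hε']

/-- The predicted statistic attains the misspecified Cramer-Rao bound asymptotically. -/
lemma RegularModel.tendsto_predictedStatistic [IsProbabilityMeasure μ]
    [IsProbabilityMeasure P]
    (h : RegularModel P f a b bd) (hI : IsIIDSample X P μ) (ht : t ∈ Ioo a b)
    (hmax : ∀ θ ∈ Icc a b, θ ≠ t → ∫ x, dLog f a b 0 x θ ∂P < ∫ x, dLog f a b 0 x t ∂P)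
    (hA : meanHessian P f a b t ≠ 0) :
    Tendsto (fun N : ℕ => (N : ℝ) * predictedStatistic μ X f a b t N) atTop
      (𝓝 (mcrlb P f a b t)) := by
  have htI := Ioo_subset_Icc_self ht
  choose T hT hTae using fun N => hI.exists_measurableSet_likelihood_ge h htI N
  simp only [fun N : ℕ => predictedStatistic_eq h.lt.le (hT N) (hTae N)]
  refine h.tendsto_mul_integral hI ht hmax hA
    (D := 2 * ∫ ε in Icc ((a - t) / 2) ((b - t) / 2), |ε|)
    (fun N => (integrable_section_abs (hT N) _ _).const_mul 2)
    (fun N => .of_forall fun ω => mul_nonneg zero_le_two (integral_nonneg fun ε => abs_nonneg ε))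
    (fun N => .of_forall fun ω => mul_le_mul_of_nonneg_left
      (setIntegral_mono_set continuous_abs.integrableOn_Icc (.of_forall fun ε => abs_nonneg ε)
        (LE.le.eventuallyLE inter_subset_left)) zero_le_two) ?_
  intro α η δ hη hηα hδ hδs N hN
  filter_upwards [hI.ae_forall h.regular, hTae N] with ω hω hTω hq
  have hta : a ≤ t - δ := (hδs (by simp [abs_of_pos hδ] : t - δ ∈ Metric.closedBall t δ)).1
  have htb : t + δ ≤ b := (hδs (by simp [abs_of_pos hδ] : t + δ ∈ Metric.closedBall t δ)).2
  -- The displacement `u = θ - t` ranges over `[a - t, b - t]`, which contains `[-δ, δ]`.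
  refine setIntegral_abs_nonneg_set_bounds
    (d := fun u => empMean X N (fun x => dLog f a b 0 x (t + u)) ω -
      empMean X N (fun x => dLog f a b 0 x t) ω)
    (T := {ε | (ε, ω) ∈ T N}) hη hηα (by linarith) (by linarith) hq.small (fun ε hε => ?_)
    (fun u hu hδu => ?_) hq.near
  · rw [mem_ofPred_eq, hTω ε hε, ge_iff_le, sub_nonneg]
    exact likelihood_le_iff_empMean hω hN htI ⟨by linarith [hε.1], by linarith [hε.2]⟩
  · rw [sub_neg]
    exact hq.far _ ⟨by linarith [hu.1], by linarith [hu.2]⟩ (by simpa using hδu.le)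

end PredictedAsymptotics

/-! ### Divergence as a difference of expected log-densities. -/

section KullbackLeibler

variable {𝒳 : Type*} [MeasurableSpace 𝒳] {ν : Measure 𝒳} {g : 𝒳 → ℝ}

lemma IsDensity.isProbabilityMeasure_law (hg : IsDensity ν g) : IsProbabilityMeasure (law ν g) :=
  ⟨by rw [law, withDensity_apply _ MeasurableSet.univ, Measure.restrict_univ, hg.2.2]⟩

lemma IsDensity.integral_law (hg : IsDensity ν g) (k : 𝒳 → ℝ) :
    ∫ x, k x ∂(law ν g) = ∫ x, g x * k x ∂ν := by
  rw [law, integral_withDensity_eq_integral_toReal_smul hg.1.ennreal_ofReal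
    (.of_forall fun x => ENNReal.ofReal_lt_top)]
  simp [ENNReal.toReal_ofReal, hg.2.1]

lemma IsDensity.ae_pos_law (hg : IsDensity ν g) : ∀ᵐ x ∂(law ν g), 0 < g x := by
  rw [law, ae_withDensity_iff hg.1.ennreal_ofReal]
  exact .of_forall fun x hx => by simpa using hx

lemma IsDensity.klDivergence_eq (hg : IsDensity ν g) {k : 𝒳 → ℝ}
    (hgi : Integrable (fun x => Real.log (g x)) (law ν g))
    (hki : Integrable (fun x => Real.log (k x)) (law ν g)) (hk : ∀ᵐ x ∂(law ν g), 0 < k x) :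
    klDivergence ν g k = ∫ x, Real.log (g x) ∂(law ν g) - ∫ x, Real.log (k x) ∂(law ν g) := by
  rw [klDivergence, ← hg.integral_law fun x => Real.log (g x / k x), ← integral_sub hgi hki]
  refine integral_congr_ae ?_
  filter_upwards [hg.ae_pos_law, hk] with x h1 h2
  exact Real.log_div h1.ne' h2.ne'

end KullbackLeibler

end MML

theorem proposition2 {𝒳 : Type*} [MeasurableSpace 𝒳] (ν : Measure 𝒳)
    -- the true density and the assumed parametric family of densities
    (fbar : 𝒳 → ℝ) (f : 𝒳 → ℝ → ℝ) (θmin θmax θstar : ℝ)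
    (hfbar : MML.IsDensity ν fbar)
    (hf : ∀ θ ∈ Icc θmin θmax, MML.IsDensity ν (fun x => f x θ))
    -- independent measurements with the true density
    {Ω : Type*} [MeasurableSpace Ω] (μ : Measure Ω) [IsProbabilityMeasure μ]
    (X : ℕ → Ω → 𝒳) (hX : ∀ n, Measurable (X n)) (hindep : iIndepFun X μ)
    (hlaw : ∀ n, μ.map (X n) = MML.law ν fbar)
    -- `ln f(x;θ)` makes sense and is three times continuously differentiable in `θ`
    (hA1 : ∀ᵐ x ∂(MML.law ν fbar), (∀ θ ∈ Icc θmin θmax, 0 < f x θ) ∧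
      ContDiffOn ℝ 3 (fun θ => Real.log (f x θ)) (Icc θmin θmax))
    -- domination by functions of finite variance
    (b : ℕ → 𝒳 → ℝ) (hb : ∀ i ≤ 3, MemLp (b i) 2 (MML.law ν fbar))
    (hA2 : ∀ᵐ x ∂(MML.law ν fbar), ∀ i ≤ 3, ∀ θ ∈ Icc θmin θmax,
      |MML.dLog f θmin θmax i x θ| ≤ b i x)
    -- existence and unique interior minimum of the Kullback-Leibler divergence
    (hent : Integrable (fun x => Real.log (fbar x)) (MML.law ν fbar))
    (hstar : θstar ∈ Ioo θmin θmax)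
    (hA3 : ∀ θ ∈ Icc θmin θmax, θ ≠ θstar →
      MML.klDivergence ν fbar (fun x => f x θstar) < MML.klDivergence ν fbar (fun x => f x θ))
    -- the misspecified maximum likelihood estimator
    (θhat : (N : ℕ) → (Fin N → 𝒳) → ℝ) (hθmeas : ∀ N, Measurable (θhat N))
    (hθhat : ∀ N, ∀ᵐ ω ∂μ, θhat N (MML.sample X N ω) ∈ Icc θmin θmax ∧
      IsMaxOn (MML.likelihood f (MML.sample X N ω)) (Icc θmin θmax)
        (θhat N (MML.sample X N ω))) :
    -- the integral defining the predicted statistic converges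
    (∀ N, IntervalIntegrable (MML.predictedIntegrand μ X f θstar N) volume
      ((θmin - θstar) / 2) ((θmax - θstar) / 2)) ∧
    -- misspecified consistency
    (∀ᵐ ω ∂μ, Tendsto (fun N => θhat N (MML.sample X N ω)) atTop (𝓝 θstar)) ∧
    (MML.meanHessian (MML.law ν fbar) f θmin θmax θstar ≠ 0 →
      -- the predicted statistic converges to the asymptotic variance
      (∃ V : ℝ, MML.HasAsymptoticVariance μ X θhat θstar V ∧
        Tendsto (fun N : ℕ =>
          (N : ℝ) * MML.predictedStatistic μ X f θmin θmax θstar N) atTop (𝓝 V)) ∧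
      -- and to the misspecified Cramer-Rao lower bound for an efficient estimator
      (MML.AsymptoticallyMisspecifiedEfficient μ X (MML.law ν fbar) f θmin θmax θhat θstar →
        Tendsto (fun N : ℕ =>
          (N : ℝ) * MML.predictedStatistic μ X f θmin θmax θstar N) atTop
          (𝓝 (MML.meanSqScore (MML.law ν fbar) f θmin θmax θstar /
            MML.meanHessian (MML.law ν fbar) f θmin θmax θstar ^ 2)))) := by
  have := hfbar.isProbabilityMeasure_law
  have hab : θmin < θmax := hstar.1.trans hstar.2
  have hI : MML.IsIIDSample X (MML.law ν fbar) μ := ⟨hX, hindep, hlaw⟩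
  have hreg : MML.RegularModel (MML.law ν fbar) f θmin θmax b :=
    { lt := hab
      measurable := fun θ hθ => (hf θ hθ).1
      regular := by
        filter_upwards [hA1, hA2] with x h1 h2 using ⟨h1.1, h1.2, h2⟩
      memLp_bound := hb }
  have hstarI := Ioo_subset_Icc_self hstar
  have hkl : ∀ θ ∈ Icc θmin θmax, MML.klDivergence ν fbar (fun x => f x θ) =
      ∫ x, Real.log (fbar x) ∂(MML.law ν fbar) -
        ∫ x, MML.dLog f θmin θmax 0 x θ ∂(MML.law ν fbar) := fun θ hθ => by
    have hint := (hreg.memLp_log hθ).integrable one_le_two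
    simp only [MML.dLog_zero] at hint ⊢
    refine hfbar.klDivergence_eq hent hint ?_
    filter_upwards [hA1] with x hx using hx.1 θ hθ
  -- The entropy term is finite and independent of `θ`, so minimizing the divergence is maximizing
  -- the expected log-density.
  have hmax : ∀ θ ∈ Icc θmin θmax, θ ≠ θstar →
      ∫ x, MML.dLog f θmin θmax 0 x θ ∂(MML.law ν fbar) <
        ∫ x, MML.dLog f θmin θmax 0 x θstar ∂(MML.law ν fbar) := fun θ hθ hne => by
    have := hA3 θ hθ hne
    rw [hkl θ hθ, hkl θstar hstarI] at this
    linarith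
  refine ⟨fun N => ?_, hreg.ae_tendsto_estimator hI hstar hmax hθhat, fun hA => ?_⟩
  · obtain ⟨T, hT, hTae⟩ := hI.exists_measurableSet_likelihood_ge hreg hstarI N
    rw [intervalIntegrable_iff_integrableOn_Icc_of_le (by linarith)]
    exact MML.integrableOn_predictedIntegrand hT hTae
  · have hlim := hreg.tendsto_predictedStatistic hI hstar hmax hA
    exact ⟨⟨_, hreg.hasAsymptoticVariance hI hstar hmax hA hθmeas hθhat, hlim⟩, fun _ => hlim⟩
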